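/- Let $M$ be a smooth oriented Riemannian manifold (without boundary, not necessarily compact) of dimension $d\ge 2$, with Hodge star $\star$ (so $\alpha\wedge\star\beta=\langle\alpha,\beta\rangle\star 1$), Levi-Civita connection $\nabla$, and codifferential $\mathrm d^*=(-1)^{d(k+1)+1}\star\mathrm d\star$ on $k$-forms. The inner product of $k$-forms is normalized so that $e^{i_1}\wedge\dots\wedge e^{i_k}$, $i_1<\dots<i_k$, are orthonormal for an orthonormal coframe $(e^i)$. For a $(d-1)$-form $F$ of class $C^1$, let $\langle\nabla F,F\rangle$ be the $1$-form $u\mapsto\langle\nabla_uF,F\rangle$, and let $\iota(\theta,F)$ be the contraction of the vector dual to the $1$-form $\theta$ with the first slot of $F$. A $(d-1)$-form $F$ is called $p$-tight if $F$ and $|F|^{p-2}F$ are locally integrable and $$\mathrm dF=0,\qquad \mathrm d^*(|F|^{p-2}F)=0$$ in the sense of distributions. (1) Let $2<p<\infty$ and let $F$ be a $p$-tight form of class $C^1$. Then, at every point of $M$, $$\mathrm dF=0,\qquad (\star F)\wedge\mathrm d(\star F)=0,\qquad \langle\nabla F,F\rangle\wedge\star F+\frac{|F|^2}{p-2}\,\mathrm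 d\star F=0,$$ and also $$\iota(\langle\nabla F,F\rangle,F)-\frac{|F|^2}{p-2}\,\mathrm d^*F=0.$$ (2) Let $F_p$ be a $p$-tight form for each $2<p<\infty$, and suppose that $F_p\to F$ in $C^1$ (locally uniformly with first derivatives, the forms $F_p$ being $C^1$ along the limit) as $p\to\infty$, possibly only along a subsequence or subnet $p_j\to\infty$. Then, at every point of $M$, $F$ solves the tight system $$\mathrm dF=0,\qquad (\star F)\wedge\mathrm d(\star F)=0,\qquad \langle\nabla F,F\rangle\wedge\star F=0,$$ and also $$\nabla_\beta F_{\gamma_1\cdots\gamma_{d-1}}\,F^{\gamma_1\cdots\gamma_{d-1}}\,{F^\beta}_{\alpha_1\cdots\alpha_{d-2}}=0 .$$ (3) In (1) and in (2) the last displayed equation is a rewriting of the third equation of the system: for every $(d-1)$-form $F$ of class $C^1$ and every $p>2$, each equation holds at a given point of $M$ if and only if its rewriting does. -/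

import Mathlib

open Filter MeasureTheory
open scoped Manifold ContDiff Topology

noncomputable section

namespace PTight

/-! ### Alternating forms on an oriented inner product space -/

section Algebra

variable {n k l : ℕ} {V : Type*} [NormedAddCommGroup V] [InnerProductSpace ℝ V]

/-- Evaluation of the first `k` slots of a form: `(fix k f v) w = f (v, w)`, where the vectors
`v 0, …, v (k - 1)` are inserted in this order before those of `w`. -/
def fix : (k : ℕ) → (V [⋀^Fin (l + k)]→L[ℝ] ℝ) → (Fin k → V) → V [⋀^Fin l]→L[ℝ] ℝ
  | 0, f, _ => f
  | k + 1, f, v => fix k (f.curryLeft (v 0)) (Fin.tail v)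

/-- The inner product on `k`-forms for which the forms `e^{i₁} ∧ ⋯ ∧ e^{i_k}`, `i₁ < ⋯ < i_k`, are
orthonormal if `e` is an orthonormal basis. -/
def formInner [FiniteDimensional ℝ V] (α β : V [⋀^Fin k]→L[ℝ] ℝ) : ℝ :=
  (k.factorial : ℝ)⁻¹ * ∑ i : Fin k → Fin (Module.finrank ℝ V),
    α (fun j => stdOrthonormalBasis ℝ V (i j)) * β (fun j => stdOrthonormalBasis ℝ V (i j))

theorem formInner_add_left [FiniteDimensional ℝ V] (α α' β : V [⋀^Fin k]→L[ℝ] ℝ) :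
    formInner (α + α') β = formInner α β + formInner α' β := by
  simp [formInner, add_mul, Finset.sum_add_distrib, mul_add]

theorem formInner_smul_left [FiniteDimensional ℝ V] (c : ℝ) (α β : V [⋀^Fin k]→L[ℝ] ℝ) :
    formInner (c • α) β = c * formInner α β := by
  simp only [formInner, ContinuousAlternatingMap.smul_apply, smul_eq_mul, mul_assoc,
    ← Finset.mul_sum]
  ring

/-- The norm of a `k`-form. -/
def formNorm [FiniteDimensional ℝ V] (α : V [⋀^Fin k]→L[ℝ] ℝ) : ℝ := √(formInner α α)

/-- The volume form of an oriented inner product space of dimension `n`, as a continuous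
alternating map in `m = n` vectors. -/
def volForm {m : ℕ} [Fact (Module.finrank ℝ V = n)] (h : n = m) (o : Orientation ℝ V (Fin n)) :
    V [⋀^Fin m]→L[ℝ] ℝ :=
  (o.volumeForm.domDomCongr (finCongr h)).mkContinuous 1 fun v => by
    subst h
    simpa using o.abs_volumeForm_apply_le v

/-- The Hodge star `Λᵏ → Λˡ`, `k + l = n`:
`(⋆α)(w) = (1 / k!) ∑ α(e_{i₁}, …, e_{i_k}) vol(e_{i₁}, …, e_{i_k}, w)` for an orthonormal
basis `e`; so `α ∧ ⋆β = ⟨α, β⟩ vol`. -/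
def hodge [FiniteDimensional ℝ V] [Fact (Module.finrank ℝ V = n)] (h : k + l = n)
    (o : Orientation ℝ V (Fin n)) (α : V [⋀^Fin k]→L[ℝ] ℝ) : V [⋀^Fin l]→L[ℝ] ℝ :=
  (k.factorial : ℝ)⁻¹ • ∑ i : Fin k → Fin (Module.finrank ℝ V),
    α (fun j => stdOrthonormalBasis ℝ V (i j)) •
      fix k (volForm (h.symm.trans (Nat.add_comm k l)) o)
        (fun j => stdOrthonormalBasis ℝ V (i j))

/-- The vector dual to a covector. -/
def sharp [FiniteDimensional ℝ V] (θ : V →L[ℝ] ℝ) : V :=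
  ∑ a, θ (stdOrthonormalBasis ℝ V a) • stdOrthonormalBasis ℝ V a

end Algebra

section Wedge

variable {k : ℕ} {V : Type*} [NormedAddCommGroup V] [NormedSpace ℝ V]

/-- The wedge product of a covector and a `k`-form:
`(θ ∧ α)(v₀, …, v_k) = ∑ᵢ (-1)ⁱ θ(vᵢ) α(v₀, …, v̂ᵢ, …, v_k)`. -/
def wedge (θ : V →L[ℝ] ℝ) (α : V [⋀^Fin k]→L[ℝ] ℝ) : V [⋀^Fin (k + 1)]→L[ℝ] ℝ :=
  .alternatizeUncurryFin (θ.smulRight α)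

/-- A `1`-form as a covector. -/
def toCovector (α : V [⋀^Fin 1]→L[ℝ] ℝ) : V →L[ℝ] ℝ :=
  (ContinuousAlternatingMap.ofSubsingleton ℝ V ℝ (0 : Fin 1)).symm α

/-- The derivation action of an endomorphism on a form:
`(A · α)(w) = ∑ᵢ α(w₁, …, A wᵢ, …, w_k)`. -/
def act (A : V →L[ℝ] V) (α : V [⋀^Fin k]→L[ℝ] ℝ) : V [⋀^Fin k]→L[ℝ] ℝ :=
  α.fderivCompContinuousLinearMap (.id ℝ V) A

/-- For a metric `g` with variable coefficients on a vector space, the covector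
`w ↦ (∂_u g(w, z) + ∂_w g(u, z) - ∂_z g(u, w)) / 2` at the point `y`. -/
def koszul (g : V → V →L[ℝ] V →L[ℝ] ℝ) (y u z : V) : V →L[ℝ] ℝ :=
  (1 / 2 : ℝ) • ((fderiv ℝ g y u).flip z + ((fderiv ℝ g y).flip u).flip z - fderiv ℝ g y z u)

theorem act_add (A B : V →L[ℝ] V) (α : V [⋀^Fin k]→L[ℝ] ℝ) :
    act (A + B) α = act A α + act B α := map_add _ _ _

theorem act_smul (c : ℝ) (A : V →L[ℝ] V) (α : V [⋀^Fin k]→L[ℝ] ℝ) :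
    act (c • A) α = c • act A α := map_smul _ _ _

theorem koszul_add (g : V → V →L[ℝ] V →L[ℝ] ℝ) (y u v z : V) :
    koszul g y (u + v) z = koszul g y u z + koszul g y v z := by
  ext w
  simp [koszul]
  ring

theorem koszul_smul (g : V → V →L[ℝ] V →L[ℝ] ℝ) (y : V) (c : ℝ) (u z : V) :
    koszul g y (c • u) z = c • koszul g y u z := by
  ext w
  simp [koszul]
  ring

end Wedge

section Manifold

variable {n : ℕ} {M : Type*} [TopologicalSpace M] [ChartedSpace (EuclideanSpace ℝ (Fin n)) M]

/-- The tangent space of the `n`-manifold `M` at `x`. -/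
abbrev TM (n : ℕ) {M : Type*} [TopologicalSpace M] [ChartedSpace (EuclideanSpace ℝ (Fin n)) M]
    (x : M) : Type := TangentSpace (𝓡 n) x

/-- Differential `k`-forms on the `n`-manifold `M`, with no regularity. -/
abbrev Form (n : ℕ) (M : Type*) [TopologicalSpace M]
    [ChartedSpace (EuclideanSpace ℝ (Fin n)) M] (k : ℕ) : Type _ :=
  ∀ x : M, TM n x [⋀^Fin k]→L[ℝ] ℝ

instance (x : M) : FiniteDimensional ℝ (TM n x) :=
  inferInstanceAs (FiniteDimensional ℝ (EuclideanSpace ℝ (Fin n)))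

instance (x : M) : Fact (Module.finrank ℝ (TM n x) = n) :=
  ⟨(finrank_euclideanSpace_fin : Module.finrank ℝ (EuclideanSpace ℝ (Fin n)) = n)⟩

/-- The derivative of the inverse of the chart around `c`, at a point `y` of the chart target. -/
def dSymm (c : M) (y : EuclideanSpace ℝ (Fin n)) :
    EuclideanSpace ℝ (Fin n) →L[ℝ] TM n ((extChartAt (𝓡 n) c).symm y) :=
  mfderiv 𝓘(ℝ, EuclideanSpace ℝ (Fin n)) (𝓡 n) (extChartAt (𝓡 n) c).symm y

/-- The derivative at `x` of the chart around `x`. -/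
def dChart (x : M) : TM n x →L[ℝ] EuclideanSpace ℝ (Fin n) :=
  mfderiv (𝓡 n) 𝓘(ℝ, EuclideanSpace ℝ (Fin n)) (extChartAt (𝓡 n) x) x

/-- The expression of a form in the chart around `c`: its pullback by the inverse of the chart.
It is meaningful on the target of the chart. -/
def rep {k : ℕ} (η : Form n M k) (c : M) (y : EuclideanSpace ℝ (Fin n)) :
    EuclideanSpace ℝ (Fin n) [⋀^Fin k]→L[ℝ] ℝ :=
  (η ((extChartAt (𝓡 n) c).symm y)).compContinuousLinearMap (dSymm c y)

/-- A form of class `Cʳ`: its expressions in the charts are of class `Cʳ`. -/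
def IsCr {k : ℕ} (r : ℕ∞ω) (η : Form n M k) : Prop :=
  ∀ c : M, ContDiffOn ℝ r (rep η c) (extChartAt (𝓡 n) c).target

/-- The (classical) exterior derivative, computed at `x` in the chart around `x`. -/
def extD {k : ℕ} (η : Form n M k) : Form n M (k + 1) := fun x =>
  (extDeriv (rep η x) (extChartAt (𝓡 n) x x)).compContinuousLinearMap (dChart x)

/-- `η` is locally integrable and `dη = 0` in the sense of distributions: in every chart,
`∫ (dφ ∧ η)(v₀, …, v_k) dy = 0` for all test functions `φ` and all constant vectors `vᵢ`. -/
def IsWeaklyClosed {k : ℕ} (η : Form n M k) : Prop :=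
  ∀ c : M, LocallyIntegrableOn (rep η c) (extChartAt (𝓡 n) c).target volume ∧
    ∀ φ : EuclideanSpace ℝ (Fin n) → ℝ, ContDiff ℝ ∞ φ → HasCompactSupport φ →
      tsupport φ ⊆ (extChartAt (𝓡 n) c).target →
      ∀ v : Fin (k + 1) → EuclideanSpace ℝ (Fin n),
        ∫ y, wedge (fderiv ℝ φ y) (rep η c y) v = 0

/-- Convergence of forms in `C¹`: all forms are (eventually) `C¹`, and in the charts the
coefficients and their first derivatives converge locally uniformly. -/
def TendstoC1 {k : ℕ} {ι : Type*} (η : ι → Form n M k) (L : Filter ι) (η₀ : Form n M k) : Prop :=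
  (∀ᶠ i in L, IsCr 1 (η i)) ∧ IsCr 1 η₀ ∧
  ∀ c : M,
    TendstoLocallyUniformlyOn (fun i => rep (η i) c) (rep η₀ c) L (extChartAt (𝓡 n) c).target ∧
    TendstoLocallyUniformlyOn (fun i => fderiv ℝ (rep (η i) c)) (fderiv ℝ (rep η₀ c)) L
      (extChartAt (𝓡 n) c).target

/-- A choice of orientations of the tangent spaces. -/
abbrev Orient (n : ℕ) (M : Type*) [TopologicalSpace M]
    [ChartedSpace (EuclideanSpace ℝ (Fin n)) M] : Type _ :=
  ∀ x : M, Orientation ℝ (TM n x) (Fin n)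

/-- Fields of covectors on the `n`-manifold `M`, with no regularity. -/
abbrev CovectorField (n : ℕ) (M : Type*) [TopologicalSpace M]
    [ChartedSpace (EuclideanSpace ℝ (Fin n)) M] : Type _ :=
  ∀ x : M, TM n x →L[ℝ] ℝ

end Manifold

/-! ### Riemannian metrics -/

section Riemannian

open Bundle

variable {n : ℕ} {M : Type*} [TopologicalSpace M] [ChartedSpace (EuclideanSpace ℝ (Fin n)) M]
  [RiemannianBundle (fun x : M => TM n x)]

variable (n M) in
/-- The inner products of the tangent spaces form a smooth Riemannian metric on `M`. -/
abbrev IsSmoothMetric [IsManifold (𝓡 n) ∞ M] : Prop :=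
  IsContMDiffRiemannianBundle (𝓡 n) ∞ (EuclideanSpace ℝ (Fin n)) (fun x : M => TM n x)

/-- The pointwise norm of a form. -/
def normF {k : ℕ} (α : Form n M k) (x : M) : ℝ := formNorm (α x)

/-- The metric in the chart around `c`. -/
def metricRep (c : M) (y : EuclideanSpace ℝ (Fin n)) :
    EuclideanSpace ℝ (Fin n) →L[ℝ] EuclideanSpace ℝ (Fin n) →L[ℝ] ℝ :=
  (innerSL ℝ (E := TM n ((extChartAt (𝓡 n) c).symm y))).bilinearComp (dSymm c y) (dSymm c y)

/-- The Christoffel symbols of the Levi-Civita connection at `x`, in the chart around `x`: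
`christoffel x u w = Γ(u, w)`, where
`⟨Γ(u, w), z⟩ = (∂_u g(w, z) + ∂_w g(u, z) - ∂_z g(u, w)) / 2`. -/
def christoffel (x : M) (u : TM n x) : TM n x →L[ℝ] TM n x :=
  ∑ a, ((koszul (metricRep (M := M) x) (extChartAt (𝓡 n) x x) (dChart x u)
      (dChart x (stdOrthonormalBasis ℝ (TM n x) a))).comp (dChart x)).smulRight
        (stdOrthonormalBasis ℝ (TM n x) a)

/-- The Levi-Civita covariant derivative `∇_u η` of a form at `x`:
`(∇_u η)(w) = (∂_u η)(w) - ∑ᵢ η(w₁, …, Γ(u, wᵢ), …, w_k)` in the chart around `x`. -/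
def covD {k : ℕ} (η : Form n M k) (x : M) (u : TM n x) : TM n x [⋀^Fin k]→L[ℝ] ℝ :=
  (fderiv ℝ (rep η x) (extChartAt (𝓡 n) x x) (dChart x u)).compContinuousLinearMap (dChart x)
    - act (christoffel x u) (η x)

theorem christoffel_add (x : M) (u v : TM n x) :
    christoffel x (u + v) = christoffel x u + christoffel x v := by
  simp only [christoffel, map_add, koszul_add, ContinuousLinearMap.add_comp,
    ← Finset.sum_add_distrib]
  refine Finset.sum_congr rfl fun a _ => ?_
  ext w
  rw [add_apply]
  simp only [ContinuousLinearMap.smulRight_apply, add_apply, add_smul]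

theorem christoffel_smul (x : M) (c : ℝ) (u : TM n x) :
    christoffel x (c • u) = c • christoffel x u := by
  simp only [christoffel, map_smul, koszul_smul, ContinuousLinearMap.smul_comp, Finset.smul_sum]
  refine Finset.sum_congr rfl fun a _ => ?_
  ext w
  rw [smul_apply]
  simp only [ContinuousLinearMap.smulRight_apply, smul_apply, smul_smul,
    smul_eq_mul]

theorem covD_add {k : ℕ} (η : Form n M k) (x : M) (u v : TM n x) :
    covD η x (u + v) = covD η x u + covD η x v := by
  simp only [covD, christoffel_add, act_add, map_add]
  ext w
  simp only [ContinuousAlternatingMap.sub_apply, ContinuousAlternatingMap.add_apply,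
    ContinuousAlternatingMap.compContinuousLinearMap_apply]
  ring

theorem covD_smul {k : ℕ} (η : Form n M k) (x : M) (c : ℝ) (u : TM n x) :
    covD η x (c • u) = c • covD η x u := by
  simp only [covD, christoffel_smul, act_smul, map_smul]
  ext w
  simp only [ContinuousAlternatingMap.sub_apply, ContinuousAlternatingMap.smul_apply,
    ContinuousAlternatingMap.compContinuousLinearMap_apply, smul_sub]

/-- The covector field `⟨∇F, F⟩ : u ↦ ⟨∇_u F, F⟩`. -/
def gradInner {k : ℕ} (F : Form n M k) : CovectorField n M := fun x =>
  LinearMap.toContinuousLinearMap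
    { toFun := fun u => formInner (covD F x u) (F x)
      map_add' := fun u v => by
        rw [covD_add, formInner_add_left]
      map_smul' := fun c u => by
        rw [covD_smul, formInner_smul_left, RingHom.id_apply, smul_eq_mul] }

/-! ### Oriented Riemannian manifolds and `p`-tight forms -/

/-- The family of orientations `o` of the tangent spaces is an orientation of the Riemannian
manifold `M`: its Riemannian volume form is smooth. -/
def IsOrientation (o : Orient n M) : Prop :=
  IsCr ∞ (fun x => volForm rfl (o x) : Form n M n)

/-- The Hodge star of a form. -/
def star {k l : ℕ} (h : k + l = n) (o : Orient n M)
    (F : Form n M k) : Form n M l := fun x => hodge h (o x) (F x)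

/-- The wedge product of a covector field and a `k`-form. -/
def wedgeF {k : ℕ} (θ : CovectorField n M) (F : Form n M k) : Form n M (k + 1) := fun x =>
  wedge (θ x) (F x)

/-- A `1`-form as a covector field. -/
def toCovectorField (F : Form n M 1) : CovectorField n M := fun x => toCovector (F x)

/-- The codifferential `d* = (-1)^{n(j + 1) + 1} ⋆ d ⋆` on `j`-forms, `j = k + 1`. -/
def codiff {k l : ℕ} (h : k + 1 + l = n) (o : Orient n M)
    (F : Form n M (k + 1)) : Form n M k := fun x =>
  (-1 : ℝ) ^ (n * (k + 1 + 1) + 1) •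
    star (show l + 1 + k = n by omega) o (extD (star h o F)) x

/-- `F` is a `p`-tight form, of degree `k` in dimension `k + l`: `dF = 0` and
`d*(|F|^{p - 2} F) = 0`, that is `d⋆(|F|^{p - 2} F) = 0`, in the sense of distributions. -/
def IsPTight {k l : ℕ} (h : k + l = n) (o : Orient n M) (p : ℝ)
    (F : Form n M k) : Prop :=
  IsWeaklyClosed F ∧ IsWeaklyClosed (star h o (fun x => normF F x ^ (p - 2) • F x))

/-- The left-hand side of the equation
`(∇_β F_{γ₁ ⋯ γ_{k+1}}) F^{γ₁ ⋯ γ_{k+1}} F^β_{α₁ ⋯ α_k} = 0` at `x`, the components being taken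
with respect to the orthonormal basis `e` of the tangent space; this is a `k`-form in the
remaining indices `α`. -/
def indexTerm {k : ℕ} (F : Form n M (k + 1)) (x : M) (e : OrthonormalBasis (Fin n) ℝ (TM n x)) :
    TM n x [⋀^Fin k]→L[ℝ] ℝ :=
  ∑ b : Fin n, ∑ c : Fin (k + 1) → Fin n,
    (covD F x (e b) (e ∘ c) * F x (e ∘ c)) • (F x).curryLeft (e b)

/-- The equation `(∇_β F_{γ₁ ⋯ γ_{k+1}}) F^{γ₁ ⋯ γ_{k+1}} F^β_{α₁ ⋯ α_k} = 0` at `x`. -/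
def IndexEq {k : ℕ} (F : Form n M (k + 1)) (x : M) : Prop :=
  ∀ e : OrthonormalBasis (Fin n) ℝ (TM n x), indexTerm F x e = 0

/-- The interior product `ι(θ, F)` of a form with (the vector field dual to) a covector field,
inserted in the first slot. -/
def iota {k : ℕ} (θ : CovectorField n M) (F : Form n M (k + 1)) : Form n M k := fun x =>
  (F x).curryLeft (sharp (θ x))

end Riemannian

end PTight

end

/-! Put $q=|F|^2$ and $a=(p-2)/2$, so that $|F|^{p-2}=q^a$. At a point where $F\ne0$ the factor
$q^a$ is $C^1$, so the weak equation for $\star(|F|^{p-2}F)=q^a\star F$ holds classically near that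
point: integrate by parts against test functions supported there. Metric compatibility of the
connection gives $\mathrm dq=2\langle\nabla F,F\rangle$, and the Leibniz rule yields $0=\mathrm
d(q^a\star F)=q^{a-1}\bigl((p-2)\langle\nabla F,F\rangle\wedge\star F+q\,\mathrm d\star F\bigr)$.
Dividing by $q^{a-1}(p-2)$ gives the third equation. At a zero of $F$ both of its terms vanish, so
no regularity of $q^a$ is needed there (`IsPTight.wedge_gradInner_add`). Wedging with $\star F$
kills the first term, since $\star F\wedge\theta\wedge\star F=0$, and leaves the second equation.

For the limit, every equation is a continuous expression in the values and first derivatives of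
$F_p$ at one point, and $|F_p|^2/(p-2)\to0$.

The rewritings are pointwise linear algebra:
$\iota(\theta,\alpha)=(-1)^{d}\star(\theta\wedge\star\alpha)$ for a $(d-1)$-form $\alpha$
(`curryLeft_sharp_eq`), together with injectivity of $\star$. The index equation is the case where
the coefficient of $\mathrm d^*F$ is $0$, up to the factor $(d-1)!$.

The inner product and $\star$ are defined by an orthonormal basis chosen at each point, with no
regularity in the point. By `sum_smul_of_dual` that basis may be replaced by a frame constant in a
chart together with its metric dual frame, which is smooth. Smoothness of $\star$ and the formula
for $\mathrm dq$ rest on this. -/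

noncomputable section

namespace PTight

/-! ### Frames, the inner product of forms and the Hodge star -/

section Algebra

variable {n k l : ℕ} {V : Type*} [NormedAddCommGroup V] [InnerProductSpace ℝ V]

/-- Contraction over a frame and its dual is basis independent: expand each `b' i` in `e`, exchange
the sums, and reassemble each `e j` from `b`. This frees `formInner` and `hodge` from the chosen
orthonormal basis. -/
theorem sum_smul_of_dual {ι ι' W : Type*} [Fintype ι] [Fintype ι'] [AddCommGroup W] [Module ℝ W]
    (A : MultilinearMap ℝ (fun _ : Fin k => V) ℝ) (B : MultilinearMap ℝ (fun _ : Fin k => V) W)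
    (b b' : ι → V) (hb : ∀ v, ∑ i, inner ℝ (b' i) v • b i = v) (e : OrthonormalBasis ι' ℝ V) :
    ∑ i : Fin k → ι, A (fun r => b (i r)) • B (fun r => b' (i r)) =
      ∑ j : Fin k → ι', A (fun r => e (j r)) • B (fun r => e (j r)) := by
  classical
  have h1 (i : Fin k → ι) : B (fun r => b' (i r)) =
      ∑ j : Fin k → ι', (∏ r, inner ℝ (e (j r)) (b' (i r))) • B (fun r => e (j r)) := by
    conv_lhs => enter [2, r]; rw [← e.sum_repr' (b' (i r))]
    rw [MultilinearMap.map_sum]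
    exact Finset.sum_congr rfl fun j _ => B.map_smul_univ _ _
  have h2 (j : Fin k → ι') : A (fun r => e (j r)) =
      ∑ i : Fin k → ι, (∏ r, inner ℝ (b' (i r)) (e (j r))) • A (fun r => b (i r)) := by
    conv_lhs => enter [2, r]; rw [← hb (e (j r))]
    rw [MultilinearMap.map_sum]
    exact Finset.sum_congr rfl fun j _ => A.map_smul_univ _ _
  simp_rw [h1, Finset.smul_sum]
  rw [Finset.sum_comm]
  refine Finset.sum_congr rfl fun j _ => ?_
  rw [h2 j, Finset.sum_smul]
  refine Finset.sum_congr rfl fun i _ => ?_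
  rw [smul_smul, smul_eq_mul, mul_comm]
  simp_rw [real_inner_comm]

theorem fix_apply (f : V [⋀^Fin (l + k)]→L[ℝ] ℝ) (v : Fin k → V) (w : Fin l → V) :
    fix k f v w = f (Fin.append v w ∘ Fin.cast (Nat.add_comm l k)) := by
  induction k with
  | zero =>
    simp only [fix]
    congr 1
    ext i
    simp [Fin.append, Fin.addCases]
  | succ k ih =>
    rw [fix, ih, ContinuousAlternatingMap.curryLeft_apply_apply]
    congr 1
    funext i
    induction i using Fin.cases with
    | zero => simp [Fin.append, Fin.addCases]; rfl
    | succ i =>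
      simp only [Matrix.vecCons, Fin.cons_succ, Function.comp_apply]
      conv_rhs => rw [← Fin.cons_self_tail v, Fin.append_cons]
      rfl

theorem append_update_comp_cast [DecidableEq (Fin k)] {X : Type*} (v : Fin k → X) (w : Fin l → X)
    (a : Fin k) (x : X) :
    Fin.append (Function.update v a x) w ∘ Fin.cast (Nat.add_comm l k) =
      Function.update (Fin.append v w ∘ Fin.cast (Nat.add_comm l k))
        (Fin.cast (Nat.add_comm k l) (Fin.castAdd l a)) x := by
  funext i
  obtain ⟨i, rfl⟩ := (finCongr (Nat.add_comm k l)).surjective i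
  induction i using Fin.addCases with
  | left i =>
    by_cases h : i = a
    · subst h; simp
    · simp [h]
  | right i =>
    have : Fin.cast (Nat.add_comm k l) (Fin.natAdd k i) ≠
        Fin.cast (Nat.add_comm k l) (Fin.castAdd l a) := by
      intro h; simp [Fin.ext_iff] at h; omega
    rw [finCongr_apply, Function.update_of_ne this]
    simp

/-- `fix` as an alternating map in the fixed vectors. -/
def fixAlt (f : V [⋀^Fin (l + k)]→L[ℝ] ℝ) : V [⋀^Fin k]→ₗ[ℝ] (V [⋀^Fin l]→L[ℝ] ℝ) where
  toFun v := fix k f v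
  map_update_add' v a x y := by
    ext w
    simp only [fix_apply, append_update_comp_cast, ContinuousAlternatingMap.map_update_add,
      ContinuousAlternatingMap.add_apply]
  map_update_smul' v a c x := by
    ext w
    simp only [fix_apply, append_update_comp_cast, ContinuousAlternatingMap.map_update_smul,
      ContinuousAlternatingMap.smul_apply]
  map_eq_zero_of_eq' v a b h hab := by
    ext w
    rw [fix_apply]
    refine f.map_eq_zero_of_eq _ (i := Fin.cast (Nat.add_comm k l) (Fin.castAdd l a))
      (j := Fin.cast (Nat.add_comm k l) (Fin.castAdd l b)) ?_ ?_
    · simp [h]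
    · simpa using hab

theorem fixAlt_apply (f : V [⋀^Fin (l + k)]→L[ℝ] ℝ) (v : Fin k → V) : fixAlt f v = fix k f v := rfl

theorem fix_apply_eq_zero (f : V [⋀^Fin (l + k)]→L[ℝ] ℝ) (v : Fin k → V) (w : Fin l → V)
    {a : Fin k} {b : Fin l} (h : v a = w b) : fix k f v w = 0 := by
  rw [fix_apply]
  refine f.map_eq_zero_of_eq _ (i := Fin.cast (Nat.add_comm k l) (Fin.castAdd l a))
      (j := Fin.cast (Nat.add_comm k l) (Fin.natAdd k b)) ?_ ?_
  · simp [h]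
  · intro h; simp [Fin.ext_iff] at h; omega

theorem fix_compContinuousLinearMap {W : Type*} [NormedAddCommGroup W] [InnerProductSpace ℝ W]
    (f : V [⋀^Fin (l + k)]→L[ℝ] ℝ) (A : W →L[ℝ] V) (v : Fin k → W) :
    fix k (f.compContinuousLinearMap A) v =
      (fix k f (fun i => A (v i))).compContinuousLinearMap A := by
  induction k with
  | zero => rfl
  | succ k ih =>
    rw [fix, fix, ContinuousAlternatingMap.curryLeft_compContinuousLinearMap, ih]
    rfl

theorem contDiffAt_fix {E : Type*} [NormedAddCommGroup E] [NormedSpace ℝ E] {r : ℕ∞ω}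
    {f : E → V [⋀^Fin (l + k)]→L[ℝ] ℝ} {v : E → Fin k → V} {y : E} (hf : ContDiffAt ℝ r f y)
    (hv : ∀ i, ContDiffAt ℝ r (fun y => v y i) y) :
    ContDiffAt ℝ r (fun y => fix k (f y) (v y)) y := by
  induction k with
  | zero => exact hf
  | succ k ih =>
    refine ih (f := fun y => (f y).curryLeft (v y 0)) ?_ fun i => hv i.succ
    exact ((ContinuousAlternatingMap.curryLeftLI (𝕜 := ℝ) (E := V)
      (F := ℝ)).toContinuousLinearMap.contDiff.contDiffAt.comp y hf).clm_apply (hv 0)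

theorem volForm_apply {m : ℕ} [Fact (Module.finrank ℝ V = n)] (h : n = m)
    (o : Orientation ℝ V (Fin n)) (v : Fin m → V) :
    volForm h o v = o.volumeForm (v ∘ finCongr h) := rfl

theorem volForm_sq {m : ℕ} [Fact (Module.finrank ℝ V = n)] {ι : Type*} [Fintype ι]
    (h : n = m) (o : Orientation ℝ V (Fin n)) (e : OrthonormalBasis ι ℝ V) (j : Fin m → ι)
    (hj : Function.Injective j) : volForm h o (fun r => e (j r)) ^ 2 = 1 := by
  subst h
  have hc : Fintype.card (Fin n) = Fintype.card ι := by
    rw [← Module.finrank_eq_card_basis e.toBasis, Fintype.card_fin]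
    exact (Fact.out : Module.finrank ℝ V = n).symm
  have hb := (Fintype.bijective_iff_injective_and_card j).2 ⟨hj, hc⟩
  have := o.abs_volumeForm_apply_of_orthonormal (e.reindex (Equiv.ofBijective j hb).symm)
  rw [volForm_apply, ← sq_abs]
  have h2 : ((fun r => e (j r)) ∘ finCongr (rfl : n = n)) =
      ⇑(e.reindex (Equiv.ofBijective j hb).symm) := by
    ext; simp
  rw [h2, this, one_pow]

/-- Only the rearrangements `j ∘ σ` contribute, and each contributes equally; the factor cancels the
`1 / k!` in the definitions. -/
theorem sum_eq_factorial_mul {ι : Type*} [Fintype ι] (f : (Fin k → ι) → ℝ)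
    (j : Fin k → ι) (hj : Function.Injective j) (hf : ∀ σ : Equiv.Perm (Fin k), f (j ∘ σ) = f j)
    (h0 : ∀ i, f i ≠ 0 → Function.Injective i ∧ ∀ a, i a ∈ Set.range j) :
    ∑ i, f i = k.factorial * f j := by
  classical
  have h1 : ∑ i, f i = ∑ i ∈ Finset.univ.image (fun σ : Equiv.Perm (Fin k) => j ∘ σ), f i := by
    symm
    refine Finset.sum_subset (Finset.subset_univ _) fun i _ hi => ?_
    by_contra hne
    obtain ⟨hinj, hr⟩ := h0 i hne
    choose s hs using hr
    have hsi : Function.Injective s := fun a b hab => hinj (by rw [← hs a, ← hs b, hab])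
    refine hi (Finset.mem_image.2 ⟨Equiv.ofBijective s (Finite.injective_iff_bijective.1 hsi),
      Finset.mem_univ _, funext fun a => hs a⟩)
  rw [h1, Finset.sum_image]
  · simp [hf, Fintype.card_perm]
  · intro σ _ τ _ h
    exact Equiv.ext fun a => hj (congrFun h a)

theorem wedge_apply_one (θ : V →L[ℝ] ℝ) (s : V [⋀^Fin 1]→L[ℝ] ℝ) (v : Fin 2 → V) :
    wedge θ s v = θ (v 0) * toCovector s (v 1) - θ (v 1) * toCovector s (v 0) := by
  have h0 : Fin.removeNth 0 v = fun _ => v 1 := by ext i; fin_cases i; rfl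
  have h1 : Fin.removeNth 1 v = fun _ => v 0 := by ext i; fin_cases i; rfl
  rw [wedge, ContinuousAlternatingMap.alternatizeUncurryFin_apply]
  simp [Fin.sum_univ_two, h0, h1, sub_eq_add_neg]
  rfl

theorem fix_volForm_sq [Fact (Module.finrank ℝ V = n)] {ι : Type*} [Fintype ι]
    (h : k + l = n) (o : Orientation ℝ V (Fin n)) (e : OrthonormalBasis ι ℝ V) (j : Fin k → ι) (w : Fin l → ι) (hj : Function.Injective j)
    (hw : Function.Injective w) (hd : ∀ a b, j a ≠ w b) :
    fix k (volForm (h.symm.trans (Nat.add_comm k l)) o) (fun r => e (j r)) (fun r => e (w r)) ^ 2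
      = 1 := by
  rw [fix_apply]
  have := volForm_sq (h.symm.trans (Nat.add_comm k l)) o e
    (Fin.append j w ∘ Fin.cast (Nat.add_comm l k))
    ((Fin.append_injective_iff.2 ⟨hj, hw, hd⟩).comp (Fin.cast_injective _))
  rw [← this]
  congr 2
  funext i
  simp only [Function.comp_apply]
  generalize Fin.cast (Nat.add_comm l k) i = i
  induction i using Fin.addCases <;> simp

section Hodge

variable [FiniteDimensional ℝ V] [Fact (Module.finrank ℝ V = n)]

theorem hodge_add (h : k + l = n) (o : Orientation ℝ V (Fin n)) (α β : V [⋀^Fin k]→L[ℝ] ℝ) :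
    hodge h o (α + β) = hodge h o α + hodge h o β := by
  simp [hodge, add_smul, Finset.sum_add_distrib]

theorem hodge_smul (h : k + l = n) (o : Orientation ℝ V (Fin n)) (c : ℝ)
    (α : V [⋀^Fin k]→L[ℝ] ℝ) : hodge h o (c • α) = c • hodge h o α := by
  simp only [hodge, ContinuousAlternatingMap.smul_apply, smul_assoc, ← Finset.smul_sum]
  rw [smul_comm]

theorem hodge_zero (h : k + l = n) (o : Orientation ℝ V (Fin n)) :
    hodge h o (0 : V [⋀^Fin k]→L[ℝ] ℝ) = 0 := by
  simpa using hodge_smul h o 0 0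

theorem formInner_eq_sum {ι : Type*} [Fintype ι] (b b' : ι → V)
    (hb : ∀ v, ∑ i, inner ℝ (b' i) v • b i = v) (α β : V [⋀^Fin k]→L[ℝ] ℝ) :
    formInner α β = (k.factorial : ℝ)⁻¹ * ∑ i : Fin k → ι,
      α (fun r => b (i r)) * β (fun r => b' (i r)) := by
  have := sum_smul_of_dual α.toMultilinearMap β.toMultilinearMap b b' hb
    (stdOrthonormalBasis ℝ V)
  simp only [smul_eq_mul] at this
  exact congrArg _ this.symm

theorem hodge_eq_sum {ι : Type*} [Fintype ι] (b b' : ι → V)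
    (hb : ∀ v, ∑ i, inner ℝ (b' i) v • b i = v) (h : k + l = n) (o : Orientation ℝ V (Fin n))
    (α : V [⋀^Fin k]→L[ℝ] ℝ) :
    hodge h o α = (k.factorial : ℝ)⁻¹ • ∑ i : Fin k → ι, α (fun r => b (i r)) •
      fix k (volForm (h.symm.trans (Nat.add_comm k l)) o) (fun r => b' (i r)) :=
  congrArg _ (sum_smul_of_dual α.toMultilinearMap (fixAlt (volForm _ o)).toMultilinearMap b b' hb
    (stdOrthonormalBasis ℝ V)).symm

theorem formInner_self_nonneg (α : V [⋀^Fin k]→L[ℝ] ℝ) : 0 ≤ formInner α α :=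
  mul_nonneg (by positivity) (Finset.sum_nonneg fun _ _ => mul_self_nonneg _)

theorem formInner_self_eq_zero {α : V [⋀^Fin k]→L[ℝ] ℝ} (h : formInner α α = 0) : α = 0 := by
  rw [formInner, mul_eq_zero, Finset.sum_eq_zero_iff_of_nonneg fun _ _ => mul_self_nonneg _] at h
  have h := h.resolve_left (by positivity)
  refine ContinuousAlternatingMap.toAlternatingMap_injective
    ((stdOrthonormalBasis ℝ V).toBasis.ext_alternating fun i _ => ?_)
  simpa using h i (Finset.mem_univ _)

/-- An index repeating a value kills `α`, and one meeting `w` kills the volume form. What remains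
are the permutations of `j`, whose sign occurs once in each factor and cancels. -/
theorem hodge_apply_basis (h : k + l = n) (o : Orientation ℝ V (Fin n))
    (j : Fin k → Fin (Module.finrank ℝ V)) (w : Fin l → Fin (Module.finrank ℝ V))
    (hj : Function.Injective j) (hw : Function.Injective w) (hd : ∀ a b, j a ≠ w b)
    (α : V [⋀^Fin k]→L[ℝ] ℝ) :
    hodge h o α (fun r => stdOrthonormalBasis ℝ V (w r)) =
      α (fun r => stdOrthonormalBasis ℝ V (j r)) *
        fix k (volForm (h.symm.trans (Nat.add_comm k l)) o)
          (fun r => stdOrthonormalBasis ℝ V (j r)) (fun r => stdOrthonormalBasis ℝ V (w r)) := by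
  classical
  set e := stdOrthonormalBasis ℝ V
  set Ω := volForm (h.symm.trans (Nat.add_comm k l)) o
  have key := sum_eq_factorial_mul
    (fun i : Fin k → Fin (Module.finrank ℝ V) =>
      α (fun r => e (i r)) * fix k Ω (fun r => e (i r)) (fun r => e (w r))) j hj ?_ ?_
  · simp only [hodge, ContinuousAlternatingMap.smul_apply, ContinuousAlternatingMap.sum_apply,
      smul_eq_mul]
    rw [key, inv_mul_cancel_left₀ (by positivity)]
  · intro σ
    have h1 := α.toAlternatingMap.map_perm (fun r => e (j r)) σ
    have h2 := congrArg (fun f => f (fun r => e (w r)))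
      ((fixAlt Ω).map_perm (fun r => e (j r)) σ)
    simp only [fixAlt_apply, ContinuousAlternatingMap.coe_toAlternatingMap] at h1 h2
    have h1' : α (fun r => e ((j ∘ σ) r)) = _ := h1
    have h2' : fix k Ω (fun r => e ((j ∘ σ) r)) (fun r => e (w r)) = _ := h2
    rw [h1', h2']
    rcases Int.units_eq_one_or (Equiv.Perm.sign σ) with hs | hs <;> simp [hs]
  · intro i hi
    have hinj : Function.Injective i := by
      intro a b hab
      by_contra hne
      refine hi ?_
      rw [α.map_eq_zero_of_eq _ (i := a) (j := b) (by rw [hab]) hne, zero_mul]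
    refine ⟨hinj, ?_⟩
    have hnw (a : Fin k) (b : Fin l) : i a ≠ w b := by
      intro hab
      refine hi ?_
      rw [fix_apply_eq_zero Ω _ _ (a := a) (b := b) (by rw [hab]), mul_zero]
    have hcard : k + l = Module.finrank ℝ V := h.trans (Fact.out : Module.finrank ℝ V = n).symm
    have hb : Function.Bijective (Fin.append j w) :=
      (Fintype.bijective_iff_injective_and_card _).2
        ⟨Fin.append_injective_iff.2 ⟨hj, hw, hd⟩, by simpa using hcard⟩
    intro a
    obtain ⟨c, hc⟩ := hb.2 (i a)
    induction c using Fin.addCases with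
    | left c => exact ⟨c, by simpa using hc⟩
    | right c => exact absurd hc.symm (by simpa using hnw a c)

theorem exists_complement {N : ℕ} (h : k + l = N) (j : Fin k → Fin N)
    (hj : Function.Injective j) :
    ∃ w : Fin l → Fin N, Function.Injective w ∧ ∀ a b, j a ≠ w b := by
  classical
  have hc : (Finset.univ.image j)ᶜ.card = l := by
    rw [Finset.card_compl, Finset.card_image_of_injective _ hj]
    simp
    omega
  refine ⟨(Finset.univ.image j)ᶜ.orderEmbOfFin hc, (Finset.orderEmbOfFin _ hc).injective,
    fun a b hab => ?_⟩
  have := Finset.orderEmbOfFin_mem (Finset.univ.image j)ᶜ hc b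
  rw [← hab] at this
  simp at this

/-- Each basis component of `α` is, up to sign, the complementary component of `⋆α`, so the formula
for `⋆⋆` is not needed. -/
theorem eq_zero_of_hodge_eq_zero (h : k + l = n) (o : Orientation ℝ V (Fin n))
    {α : V [⋀^Fin k]→L[ℝ] ℝ} (hα : hodge h o α = 0) : α = 0 := by
  refine ContinuousAlternatingMap.toAlternatingMap_injective
    ((stdOrthonormalBasis ℝ V).toBasis.ext_alternating fun j hj => ?_)
  obtain ⟨w, hw, hd⟩ := exists_complement
    (h.trans (Fact.out : Module.finrank ℝ V = n).symm) j hj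
  have h1 := hodge_apply_basis h o j w hj hw hd α
  have h2 := fix_volForm_sq h o (stdOrthonormalBasis ℝ V) j w hj hw hd
  rw [hα] at h1
  have h3 := (mul_eq_zero.1 h1.symm).resolve_right fun h0 => by rw [h0] at h2; norm_num at h2
  simpa using h3

/-- Recovers `α` from the vector dual to `⋆α`, inserted in the last slot of the volume form. On
basis vectors only the direction missing from `j` survives, and its volume coefficient appears
squared. -/
theorem fix_volForm_sharp_hodge (h : k + 1 = n) (o : Orientation ℝ V (Fin n))
    (α : V [⋀^Fin k]→L[ℝ] ℝ) (v : Fin k → V) :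
    fix k (volForm (h.symm.trans (Nat.add_comm k 1)) o) v
      (fun _ => sharp (toCovector (hodge h o α))) = α v := by
  set Ω := volForm (h.symm.trans (Nat.add_comm k 1)) o with hΩ
  set e := stdOrthonormalBasis ℝ V with he
  set T : (V [⋀^Fin 1]→L[ℝ] ℝ) →ₗ[ℝ] ℝ :=
    { toFun := fun β => β (fun _ => sharp (toCovector (hodge h o α)))
      map_add' := fun _ _ => rfl
      map_smul' := fun _ _ => rfl } with hT
  suffices T.compAlternatingMap (fixAlt Ω) = α.toAlternatingMap from
    congrArg (fun f => f v) this
  refine e.toBasis.ext_alternating fun j hj => ?_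
  obtain ⟨w, hw, hd⟩ := exists_complement
    (h.trans (Fact.out : Module.finrank ℝ V = n).symm) j hj
  have h1 := hodge_apply_basis h o j w hj hw hd α
  have h2 := fix_volForm_sq h o e j w hj hw hd
  have hcard : k + 1 = Module.finrank ℝ V := h.trans (Fact.out : Module.finrank ℝ V = n).symm
  have hb : Function.Bijective (Fin.append j w) :=
    (Fintype.bijective_iff_injective_and_card _).2
      ⟨Fin.append_injective_iff.2 ⟨hj, hw, hd⟩, by simpa using hcard⟩
  have hone (β : V [⋀^Fin 1]→L[ℝ] ℝ) (u : V) : β (fun _ => u) = toCovector β u := rfl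
  have h3 : toCovector (fix k Ω (fun r => e (j r))) (sharp (toCovector (hodge h o α))) =
      α (fun r => e (j r)) := by
    simp only [sharp, map_sum, map_smul, smul_eq_mul]
    rw [Finset.sum_eq_single (w 0)]
    · rw [← hone, ← hone]
      have hw0 : (fun _ : Fin 1 => e (w 0)) = fun r => e (w r) := by
        funext r; rw [Subsingleton.elim r 0]
      rw [hw0, h1, mul_assoc, ← sq, h2, mul_one]
    · intro a _ ha
      obtain ⟨c, hc⟩ := hb.2 a
      induction c using Fin.addCases with
      | left c =>
        rw [← hone (fix k Ω _), fix_apply_eq_zero Ω _ _ (a := c) (b := 0), mul_zero]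
        rw [← hc, Fin.append_left]
      | right c =>
        refine absurd hc.symm ?_
        rw [Fin.append_right, Subsingleton.elim c 0]
        exact ha
    · simp
  have hT' (β : V [⋀^Fin 1]→L[ℝ] ℝ) :
    T β = toCovector β (sharp (toCovector (hodge h o α))) := rfl
  simpa [hT', fixAlt_apply] using h3

end Hodge

end Algebra

/-! ### Interior product as a conjugate of the wedge product, and skew endomorphisms -/

section Algebra

variable {n k l m : ℕ} {V : Type*} [NormedAddCommGroup V] [InnerProductSpace ℝ V]

theorem insertNth_one_vecCons {X : Type*} (u s : X) (w : Fin m → X) :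
    Fin.insertNth (α := fun _ => X) (1 : Fin (m + 2)) s (Matrix.vecCons u w) =
      Matrix.vecCons u (Matrix.vecCons s w) := by
  symm
  rw [Fin.eq_insertNth_iff]
  refine ⟨rfl, funext fun i => ?_⟩
  induction i using Fin.cases <;> rfl

/-- The sign comes from moving `s` from the last slot past the `m` vectors `w`. -/
theorem volForm_cons_cons [Fact (Module.finrank ℝ V = n)] (h : m + 1 + 1 = n)
    (o : Orientation ℝ V (Fin n)) (u s : V) (w : Fin m → V) :
    fix (m + 1) (volForm (h.symm.trans (Nat.add_comm (m + 1) 1)) o) (Matrix.vecCons u w)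
        (fun _ => s) =
      (-1) ^ m * volForm h.symm o (Matrix.vecCons u (Matrix.vecCons s w)) := by
  subst h
  have h1 := (volForm rfl o).map_insertNth (Fin.last (m + 1)) s (Matrix.vecCons u w)
  have h2 := (volForm rfl o).map_insertNth (1 : Fin (m + 2)) s (Matrix.vecCons u w)
  have h4 : fix (m + 1) (volForm (Nat.add_comm (m + 1) 1) o) (Matrix.vecCons u w)
      (fun _ => s) = volForm rfl o (Fin.insertNth (Fin.last (m + 1)) s (Matrix.vecCons u w)) := by
    rw [fix_apply, volForm_apply, volForm_apply, Fin.insertNth_last']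
    congr 1
    funext i
    induction i using Fin.lastCases with
    | last =>
      change Fin.append (Matrix.vecCons u w) (fun _ : Fin 1 => s) (Fin.natAdd (m + 1) 0) =
        Fin.snoc (α := fun _ => V) (Matrix.vecCons u w) s (Fin.last _)
      rw [Fin.append_right, Fin.snoc_last]
    | cast i =>
      change Fin.append (Matrix.vecCons u w) (fun _ : Fin 1 => s) (Fin.castAdd 1 i) =
        Fin.snoc (α := fun _ => V) (Matrix.vecCons u w) s (Fin.castSucc i)
      rw [Fin.append_left, Fin.snoc_castSucc]
  rw [insertNth_one_vecCons] at h2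
  rw [h4, h1, h2]
  simp [pow_succ]

theorem act_apply (A : V →L[ℝ] V) (α : V [⋀^Fin k]→L[ℝ] ℝ) (v : Fin k → V) :
    act A α v = ∑ r, α (Function.update v r (A (v r))) := by
  rw [act, ContinuousAlternatingMap.fderivCompContinuousLinearMap_apply]
  refine Finset.sum_congr rfl fun r _ => congrArg α (funext fun j => ?_)
  by_cases h : j = r
  · subst h; simp
  · simp [h]

variable [FiniteDimensional ℝ V]

theorem inner_sharp (θ : V →L[ℝ] ℝ) (v : V) : inner ℝ (sharp θ) v = θ v := by
  conv_rhs => rw [← (stdOrthonormalBasis ℝ V).sum_repr' v]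
  simp [sharp, sum_inner, real_inner_smul_left, mul_comm]

theorem sharp_eq_sum {ι : Type*} [Fintype ι] (e : OrthonormalBasis ι ℝ V) (θ : V →L[ℝ] ℝ) :
    sharp θ = ∑ a, θ (e a) • e a := by
  rw [← e.sum_repr' (sharp θ)]
  simp_rw [real_inner_comm, inner_sharp]

/-- The two terms of `θ ∧ s` contribute equally because the volume form changes sign when its first
two arguments are exchanged; this absorbs the `1 / 2!` of the star. -/
theorem hodge_wedge_hodge [Fact (Module.finrank ℝ V = n)] (h : 2 + m = n)
    (o : Orientation ℝ V (Fin n)) (θ : V →L[ℝ] ℝ) (s : V [⋀^Fin 1]→L[ℝ] ℝ) (w : Fin m → V) :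
    hodge h o (wedge θ s) w = volForm (h.symm.trans (Nat.add_comm 2 m)) o
      (Matrix.vecCons (sharp θ) (Matrix.vecCons (sharp (toCovector s)) w)) := by
  set e := stdOrthonormalBasis ℝ V with he
  set Ω := volForm (h.symm.trans (Nat.add_comm 2 m)) o with hΩ
  set T : Fin (Module.finrank ℝ V) → Fin (Module.finrank ℝ V) → ℝ :=
    fun a b => Ω (Matrix.vecCons (e a) (Matrix.vecCons (e b) w)) with hT
  have hswap (a b) : T a b = - T b a := by
    have h1 := Ω.map_insertNth (1 : Fin (m + 2)) (e a) (Matrix.vecCons (e b) w)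
    rw [insertNth_one_vecCons] at h1
    simp only [hT]
    rw [h1]
    simp
  have hR : Ω (Matrix.vecCons (sharp θ) (Matrix.vecCons (sharp (toCovector s)) w)) =
      ∑ a, ∑ b, θ (e a) * toCovector s (e b) * T a b := by
    change (Ω.curryLeft (sharp θ)).curryLeft (sharp (toCovector s)) w = _
    simp only [sharp, map_sum, map_smul]
    have hc (f : V [⋀^Fin (m + 1)]→L[ℝ] ℝ) (v : V) :
        f.curryLeft v w = f (Matrix.vecCons v w) := rfl
    simp only [ContinuousAlternatingMap.sum_apply, ContinuousAlternatingMap.smul_apply, hc,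
      Finset.mul_sum, smul_eq_mul]
    rw [Finset.sum_comm]
    refine Finset.sum_congr rfl fun a _ => Finset.sum_congr rfl fun b _ => ?_
    simp only [hT, ContinuousAlternatingMap.curryLeft_apply_apply]
    ring
  have hL : hodge h o (wedge θ s) w = (1 / 2 : ℝ) * ∑ a, ∑ b,
      (θ (e a) * toCovector s (e b) - θ (e b) * toCovector s (e a)) * T a b := by
    simp only [hodge, ContinuousAlternatingMap.smul_apply, ContinuousAlternatingMap.sum_apply,
      smul_eq_mul, wedge_apply_one]
    rw [← (finTwoArrowEquiv _).symm.sum_comp, Fintype.sum_prod_type]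
    norm_num
    rfl
  rw [hL, hR]
  simp only [sub_mul, Finset.sum_sub_distrib]
  have : ∑ a, ∑ b, θ (e b) * toCovector s (e a) * T a b =
      - ∑ a, ∑ b, θ (e a) * toCovector s (e b) * T a b := by
    rw [Finset.sum_comm]
    simp only [← Finset.sum_neg_distrib]
    refine Finset.sum_congr rfl fun a _ => Finset.sum_congr rfl fun b _ => ?_
    rw [hswap b a]
    ring
  rw [this]
  ring

/-- With `s` the vector dual to `⋆α`, the left side is `vol(θ♯, w, s)` and the star on the right is
`vol(θ♯, s, w)`. -/
theorem curryLeft_sharp_eq [Fact (Module.finrank ℝ V = n)] (h : m + 1 + 1 = n) (h' : 2 + m = n)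
    (o : Orientation ℝ V (Fin n)) (θ : V →L[ℝ] ℝ) (α : V [⋀^Fin (m + 1)]→L[ℝ] ℝ) :
    α.curryLeft (sharp θ) = (-1 : ℝ) ^ m • hodge h' o (wedge θ (hodge h o α)) := by
  ext w
  rw [ContinuousAlternatingMap.smul_apply, hodge_wedge_hodge,
    ContinuousAlternatingMap.curryLeft_apply_apply, ← fix_volForm_sharp_hodge h o α,
    volForm_cons_cons h, smul_eq_mul]

theorem wedge_hodge_add_eq_zero_iff [Fact (Module.finrank ℝ V = n)] (h : m + 1 + 1 = n)
    (h' : 1 + 1 + m = n) (o : Orientation ℝ V (Fin n)) (θ : V →L[ℝ] ℝ)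
    (α : V [⋀^Fin (m + 1)]→L[ℝ] ℝ) (β : V [⋀^Fin 2]→L[ℝ] ℝ) (c : ℝ) :
    wedge θ (hodge h o α) + c • β = 0 ↔
      α.curryLeft (sharp θ) - c • (-1 : ℝ) ^ (n * (m + 1 + 1) + 1) • hodge h' o β = 0 := by
  -- The sign of the codifferential: here `m + 2 = n`, and `n * n` has the parity of `m`.
  have hs : (-1 : ℝ) ^ (n * (m + 1 + 1) + 1) = - (-1) ^ m := by
    subst h
    rw [pow_succ, pow_mul, pow_succ (-1 : ℝ) (m + 1), pow_succ]
    rcases neg_one_pow_eq_or ℝ m with hm | hm <;> rw [hm] <;> norm_num [pow_succ, hm]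
  have key : α.curryLeft (sharp θ) - c • (-1 : ℝ) ^ (n * (m + 1 + 1) + 1) • hodge h' o β =
      (-1 : ℝ) ^ m • hodge h' o (wedge θ (hodge h o α) + c • β) := by
    rw [curryLeft_sharp_eq h h' o, hs, hodge_add, hodge_smul, smul_add]
    module
  rw [key]
  constructor
  · intro h0
    rw [h0, hodge_zero, smul_zero]
  · intro h0
    refine eq_zero_of_hodge_eq_zero h' o ((smul_eq_zero.1 h0).resolve_left ?_)
    exact pow_ne_zero _ (by norm_num)

/-- Infinitesimal rotations preserve the norm of a form. -/
theorem formInner_act_of_skew (A : V →L[ℝ] V) (α : V [⋀^Fin k]→L[ℝ] ℝ)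
    (hA : ∀ a b, inner ℝ (stdOrthonormalBasis ℝ V b) (A (stdOrthonormalBasis ℝ V a)) =
      - inner ℝ (stdOrthonormalBasis ℝ V a) (A (stdOrthonormalBasis ℝ V b))) :
    formInner (act A α) α = 0 := by
  classical
  set e := stdOrthonormalBasis ℝ V with he
  have hex (i : Fin k → Fin (Module.finrank ℝ V)) (r : Fin k) :
      α (Function.update (fun j => e (i j)) r (A (e (i r)))) =
        ∑ b, inner ℝ (e b) (A (e (i r))) * α (fun j => e (Function.update i r b j)) := by
    conv_lhs => rw [← e.sum_repr' (A (e (i r)))]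
    rw [← ContinuousAlternatingMap.coe_toAlternatingMap, AlternatingMap.map_update_sum]
    refine Finset.sum_congr rfl fun b _ => ?_
    rw [AlternatingMap.map_update_smul, smul_eq_mul]
    congr 2
    funext j
    by_cases h : j = r
    · subst h; simp
    · simp [h]
  have hr (r : Fin k) : ∑ i : Fin k → Fin (Module.finrank ℝ V),
      α (Function.update (fun j => e (i j)) r (A (e (i r)))) * α (fun j => e (i j)) = 0 := by
    simp_rw [hex, Finset.sum_mul]
    rw [← Fintype.sum_prod_type' (f := fun (i : Fin k → Fin (Module.finrank ℝ V)) b =>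
      inner ℝ (e b) (A (e (i r))) * α (fun j => e (Function.update i r b j)) *
        α (fun j => e (i j)))]
    -- Exchanging the index in slot `r` with the summation index `b` turns the summand into its
    -- negative, so the sum equals its own negative.
    have hinv : Function.Involutive
        (fun p : (Fin k → Fin (Module.finrank ℝ V)) × Fin (Module.finrank ℝ V) =>
          (Function.update p.1 r p.2, p.1 r)) := by
      intro p
      simp
    refine self_eq_neg.1 ((Equiv.sum_comp hinv.toPerm _).symm.trans ?_)
    rw [← Finset.sum_neg_distrib]
    refine Finset.sum_congr rfl fun p _ => ?_
    simp only [Function.Involutive.coe_toPerm, Function.update_self, Function.update_idem,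
      Function.update_eq_self]
    rw [hA]
    ring
  rw [formInner]
  simp_rw [act_apply, Finset.sum_mul]
  rw [Finset.sum_comm, Finset.sum_eq_zero fun r _ => hr r, mul_zero]

end Algebra

/-! ### Equivalence of the equations with their rewritings -/

section Riemannian

open Bundle

variable {m : ℕ} {M : Type*} [TopologicalSpace M]
  [ChartedSpace (EuclideanSpace ℝ (Fin (m + 2))) M]
  [Bundle.RiemannianBundle (fun x : M => TM (m + 2) x)]

theorem wedge_add_smul_extD_eq_zero_iff (o : Orient (m + 2) M) (F : Form (m + 2) M (m + 1))
    (c : ℝ) (x : M) :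
    wedgeF (gradInner F) (star (l := 1) rfl o F) x + c • extD (star (l := 1) rfl o F) x = 0 ↔
      iota (gradInner F) F x - c • codiff (l := 1) rfl o F x = 0 :=
  wedge_hodge_add_eq_zero_iff rfl (by omega) (o x) (gradInner F x) (F x) _ c

/-- The unrestricted sum over the indices `γ` counts each increasing multi-index `(m + 1)!` times,
whereas `formInner` is normalized. -/
theorem indexTerm_eq (F : Form (m + 2) M (m + 1)) (x : M)
    (e : OrthonormalBasis (Fin (m + 2)) ℝ (TM (m + 2) x)) :
    indexTerm F x e = ((m + 1).factorial : ℝ) • iota (gradInner F) F x := by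
  have h1 (b : Fin (m + 2)) : ∑ c : Fin (m + 1) → Fin (m + 2),
      (covD F x (e b) (e ∘ c) * F x (e ∘ c)) =
        ((m + 1).factorial : ℝ) * gradInner F x (e b) := by
    change _ = _ * formInner _ _
    rw [formInner_eq_sum e e (fun v => e.sum_repr' v), mul_inv_cancel_left₀ (by positivity)]
    rfl
  simp only [indexTerm, iota, ← Finset.sum_smul, h1]
  rw [sharp_eq_sum e, map_sum, Finset.smul_sum]
  simp_rw [map_smul, mul_smul]

theorem indexEq_iff (F : Form (m + 2) M (m + 1)) (x : M) :
    IndexEq F x ↔ iota (gradInner F) F x = 0 := by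
  simp only [IndexEq, indexTerm_eq]
  constructor
  · intro h
    have := h ((stdOrthonormalBasis ℝ (TM (m + 2) x)).reindex (finCongr Fact.out))
    exact (smul_eq_zero.1 this).resolve_left (by positivity)
  · intro h e
    rw [h, smul_zero]

theorem wedge_eq_zero_iff_indexEq (o : Orient (m + 2) M) (F : Form (m + 2) M (m + 1)) (x : M) :
    wedgeF (gradInner F) (star (l := 1) rfl o F) x = 0 ↔ IndexEq F x := by
  rw [indexEq_iff]
  simpa using wedge_add_smul_extD_eq_zero_iff o F 0 x

end Riemannian

/-! ### From distributional to pointwise closedness -/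

section WeaklyClosed

variable {n k : ℕ}

theorem integrable_mul_of_tsupport_subset {a b : EuclideanSpace ℝ (Fin n) → ℝ}
    {U : Set (EuclideanSpace ℝ (Fin n))} (hU : IsOpen U) (ha : Continuous a)
    (hc : HasCompactSupport a) (hs : tsupport a ⊆ U) (hb : ContinuousOn b U) :
    Integrable (fun y => a y * b y) volume := by
  have hs' : tsupport (fun y => a y * b y) ⊆ tsupport a := tsupport_mul_subset_left
  refine Continuous.integrable_of_hasCompactSupport ?_ hc.mul_right
  exact (ha.continuousOn.mul hb).continuous_of_tsupport_subset hU (hs'.trans hs)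

theorem contDiffOn_alternating_apply {E : Type*} [NormedAddCommGroup E] [NormedSpace ℝ E]
    {f : E → E [⋀^Fin k]→L[ℝ] ℝ} {U : Set E} {r : ℕ∞ω} (hf : ContDiffOn ℝ r f U)
    (v : Fin k → E) : ContDiffOn ℝ r (fun y => f y v) U :=
  (ContinuousAlternatingMap.apply ℝ E ℝ v).contDiff.comp_contDiffOn hf

/-- For fixed vectors `v`, integration by parts moves the derivative from `φ` to the coefficients of
`f`. The fundamental lemma of the calculus of variations gives vanishing almost everywhere, and
continuity gives it everywhere. -/
theorem extDeriv_eq_zero_of_integral_wedge_eq_zero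
    {f : EuclideanSpace ℝ (Fin n) → EuclideanSpace ℝ (Fin n) [⋀^Fin k]→L[ℝ] ℝ}
    {U : Set (EuclideanSpace ℝ (Fin n))} (hU : IsOpen U) (hf : ContDiffOn ℝ 1 f U)
    (h : ∀ φ : EuclideanSpace ℝ (Fin n) → ℝ, ContDiff ℝ ∞ φ → HasCompactSupport φ →
      tsupport φ ⊆ U → ∀ v, ∫ y, wedge (fderiv ℝ φ y) (f y) v = 0) :
    ∀ y ∈ U, extDeriv f y = 0 := by
  suffices ∀ v, Set.EqOn (fun y => extDeriv f y v) 0 U from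
    fun y hy => ContinuousAlternatingMap.ext fun v => this v hy
  intro v
  have hd (y) (hy : y ∈ U) : DifferentiableAt ℝ f y :=
    (hf.differentiableOn one_ne_zero).differentiableAt (hU.mem_nhds hy)
  have hfi (i : Fin (k + 1)) := contDiffOn_alternating_apply hf (i.removeNth v)
  have hdfi (i : Fin (k + 1)) :
      ContinuousOn (fun y => fderiv ℝ (fun y => f y (i.removeNth v)) y (v i)) U :=
    ((hfi i).continuousOn_fderiv_of_isOpen hU le_rfl).clm_apply continuousOn_const
  have hext : Set.EqOn (fun y => extDeriv f y v) (fun y => ∑ i : Fin (k + 1),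
      (-1) ^ (i : ℕ) * fderiv ℝ (fun y => f y (i.removeNth v)) y (v i)) U := fun y hy => by
    simp [extDeriv_apply (hd y hy)]
  have hcont : ContinuousOn (fun y => extDeriv f y v) U :=
    (continuousOn_finsetSum _ fun i _ => continuousOn_const.mul (hdfi i)).congr hext
  refine Measure.eqOn_open_of_ae_eq (μ := volume) ?_ hU hcont continuousOn_const
  refine (ae_restrict_iff' hU.measurableSet).2 ?_
  refine hU.ae_eq_zero_of_integral_contDiff_smul_eq_zero
    (hcont.locallyIntegrableOn hU.measurableSet) fun φ hφ hφc hφU => ?_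
  have hφ1 : ContDiff ℝ 1 φ := hφ.of_le (by simp)
  have hi1 (i : Fin (k + 1)) : Integrable (fun y => φ y *
      fderiv ℝ (fun y => f y (i.removeNth v)) y (v i)) volume :=
    integrable_mul_of_tsupport_subset hU hφ.continuous hφc hφU (hdfi i)
  have hi2 (i : Fin (k + 1)) : Integrable (fun y => fderiv ℝ φ y (v i) *
      f y (i.removeNth v)) volume :=
    integrable_mul_of_tsupport_subset hU
      ((hφ1.continuous_fderiv one_ne_zero).clm_apply continuous_const)
      (hφc.fderiv_apply (𝕜 := ℝ) (v i)) ((tsupport_fderiv_apply_subset ℝ (v i)).trans hφU)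
      (hfi i).continuousOn
  have hi3 (i : Fin (k + 1)) : Integrable (fun y => φ y * f y (i.removeNth v)) volume :=
    integrable_mul_of_tsupport_subset hU hφ.continuous hφc hφU (hfi i).continuousOn
  have hparts (i : Fin (k + 1)) :
      ∫ y, φ y * fderiv ℝ (fun y => f y (i.removeNth v)) y (v i) =
        - ∫ y, fderiv ℝ φ y (v i) * f y (i.removeNth v) :=
    integral_mul_fderiv_eq_neg_fderiv_mul_of_integrable (hi2 i) (hi1 i) (hi3 i)
      (fun y _ => (hφ1.differentiable one_ne_zero) y)
      fun y hy => ((hfi i).differentiableOn one_ne_zero).differentiableAt (hU.mem_nhds (hφU hy))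
  have hw := h φ hφ hφc hφU v
  have hw' : ∀ y, wedge (fderiv ℝ φ y) (f y) v =
      ∑ i : Fin (k + 1), (-1) ^ (i : ℕ) * (fderiv ℝ φ y (v i) * f y (i.removeNth v)) := by
    intro y
    simp [wedge, ContinuousAlternatingMap.alternatizeUncurryFin_apply]
  simp_rw [hw'] at hw
  rw [integral_finsetSum _ fun i _ => (hi2 i).const_mul _] at hw
  have hL : ∀ y, φ y • extDeriv f y v = ∑ i : Fin (k + 1),
      (-1) ^ (i : ℕ) * (φ y * fderiv ℝ (fun y => f y (i.removeNth v)) y (v i)) := by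
    intro y
    by_cases hy : y ∈ U
    · have := hext hy
      simp only at this
      rw [this, smul_eq_mul, Finset.mul_sum]
      exact Finset.sum_congr rfl fun i _ => by ring
    · have : φ y = 0 := image_eq_zero_of_notMem_tsupport fun h => hy (hφU h)
      simp [this]
  simp_rw [hL]
  rw [integral_finsetSum _ fun i _ => (hi1 i).const_mul _]
  simp_rw [integral_const_mul, hparts, mul_neg, Finset.sum_neg_distrib]
  simp_rw [integral_const_mul] at hw
  rw [hw, neg_zero]

variable {M : Type*} [TopologicalSpace M] [ChartedSpace (EuclideanSpace ℝ (Fin n)) M]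

/-- Regularity is asked only at the point, since test functions may be confined to a small
neighbourhood. This matters for `|F|^(p-2) F`, which is treated only away from the zeros of `F`. -/
theorem IsWeaklyClosed.extDeriv_rep_eq_zero {η : Form n M k} (hη : IsWeaklyClosed η) (c : M)
    {y : EuclideanSpace ℝ (Fin n)} (hy : y ∈ (extChartAt (𝓡 n) c).target)
    (hf : ContDiffAt ℝ 1 (rep η c) y) : extDeriv (rep η c) y = 0 := by
  obtain ⟨u, hu, hfu⟩ := hf.contDiffOn le_rfl (by simp)
  obtain ⟨U, hUu, hU, hyU⟩ := mem_nhds_iff.1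
    (inter_mem hu ((isOpen_extChartAt_target c).mem_nhds hy))
  exact extDeriv_eq_zero_of_integral_wedge_eq_zero hU (hfu.mono fun z hz => (hUu hz).1)
    (fun φ h1 h2 h3 v => (hη c).2 φ h1 h2 (h3.trans fun z hz => (hUu hz).2) v) y hyU

end WeaklyClosed

/-! ### Metric, dual frame and Hodge star in a chart -/

section Chart

open Bundle

variable {n : ℕ} {M : Type*} [TopologicalSpace M] [ChartedSpace (EuclideanSpace ℝ (Fin n)) M]

/-- All tangent spaces are definitionally the same Euclidean space, so passing from `x` to the chart
inverse of its chart image needs no transport of vectors. -/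
theorem apply_congr_point {k : ℕ} (η : Form n M k) {z x : M} (hzx : z = x)
    (w : Fin k → EuclideanSpace ℝ (Fin n)) : (η z : _ → ℝ) w = (η x : _ → ℝ) w := by
  subst hzx; rfl

theorem inner_congr_point [RiemannianBundle (fun x : M => TM n x)] {z x : M}
    (hzx : z = x) (u v : EuclideanSpace ℝ (Fin n)) :
    @inner ℝ (TM n z) _ u v = @inner ℝ (TM n x) _ u v := by
  subst hzx; rfl

theorem metricRep_apply [RiemannianBundle (fun x : M => TM n x)] (c : M)
    (y u v : EuclideanSpace ℝ (Fin n)) : metricRep (M := M) c y u v = inner ℝ (dSymm c y u) (dSymm c y v) := rfl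

variable [IsManifold (𝓡 n) ∞ M]

theorem dSymm_comp_mfderiv (c : M) {y : EuclideanSpace ℝ (Fin n)}
    (hy : y ∈ (extChartAt (𝓡 n) c).target) :
    dSymm c y ∘L mfderiv (𝓡 n) 𝓘(ℝ, EuclideanSpace ℝ (Fin n)) (extChartAt (𝓡 n) c)
      ((extChartAt (𝓡 n) c).symm y) = .id ℝ _ := by
  have : IsManifold (𝓡 n) 1 M := IsManifold.of_le (n := ∞) (by simp)
  have := mfderivWithin_extChartAt_symm_comp_mfderiv_extChartAt (I := 𝓡 n) hy
  rw [ModelWithCorners.range_eq_univ, mfderivWithin_univ] at this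
  exact this

theorem mfderiv_comp_dSymm (c : M) {y : EuclideanSpace ℝ (Fin n)}
    (hy : y ∈ (extChartAt (𝓡 n) c).target) :
    mfderiv (𝓡 n) 𝓘(ℝ, EuclideanSpace ℝ (Fin n)) (extChartAt (𝓡 n) c)
      ((extChartAt (𝓡 n) c).symm y) ∘L dSymm c y = .id ℝ _ := by
  have : IsManifold (𝓡 n) 1 M := IsManifold.of_le (n := ∞) (by simp)
  have := mfderiv_extChartAt_comp_mfderivWithin_extChartAt_symm (I := 𝓡 n) hy
  rw [ModelWithCorners.range_eq_univ, mfderivWithin_univ] at this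
  exact this

theorem dSymm_injective (c : M) {y : EuclideanSpace ℝ (Fin n)}
    (hy : y ∈ (extChartAt (𝓡 n) c).target) : Function.Injective (dSymm (M := M) c y) :=
  Function.LeftInverse.injective fun v => DFunLike.congr_fun (mfderiv_comp_dSymm c hy) v

theorem dSymm_surjective (c : M) {y : EuclideanSpace ℝ (Fin n)}
    (hy : y ∈ (extChartAt (𝓡 n) c).target) : Function.Surjective (dSymm (M := M) c y) :=
  Function.RightInverse.surjective fun v => DFunLike.congr_fun (dSymm_comp_mfderiv c hy) v

theorem dSymm_dChart (x : M) (v : TM n x) :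
    (dSymm x (extChartAt (𝓡 n) x x) (dChart x v) : EuclideanSpace ℝ (Fin n)) = v := by
  have : IsManifold (𝓡 n) 1 M := IsManifold.of_le (n := ∞) (by simp)
  have := mfderivWithin_extChartAt_symm_comp_mfderiv_extChartAt' (I := 𝓡 n)
    (mem_extChartAt_source (I := 𝓡 n) x)
  rw [ModelWithCorners.range_eq_univ, mfderivWithin_univ] at this
  exact DFunLike.congr_fun this v

theorem dChart_injective (x : M) : Function.Injective (dChart (n := n) x) := fun u v h => by
  have := dSymm_dChart x u
  rw [h] at this
  exact this.symm.trans (dSymm_dChart x v)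

theorem rep_dChart {k : ℕ} (η : Form n M k) (x : M) (w : Fin k → TM n x) :
    rep η x (extChartAt (𝓡 n) x x) (fun i => dChart x (w i)) = η x w := by
  have h1 := apply_congr_point η (extChartAt_to_inv (I := 𝓡 n) x) w
  rw [← h1]
  change (η _ : _ → ℝ) (fun i => dSymm x (extChartAt (𝓡 n) x x) (dChart x (w i))) = _
  congr 1
  funext i
  exact dSymm_dChart x (w i)

variable [RiemannianBundle (fun x : M => TM n x)]

theorem metricRep_dChart (x : M) (u v : TM n x) :
    metricRep x (extChartAt (𝓡 n) x x) (dChart x u) (dChart x v) = inner ℝ u v := by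
  have h1 := inner_congr_point (extChartAt_to_inv (I := 𝓡 n) x) u v
  refine Eq.trans ?_ h1
  change inner ℝ (dSymm x (extChartAt (𝓡 n) x x) (dChart x u))
    (dSymm x (extChartAt (𝓡 n) x x) (dChart x v)) = _
  congr 1
  · exact dSymm_dChart x u
  · exact dSymm_dChart x v

/-- Each coefficient is the inner product of two coordinate fields, smooth as images of constant
fields under the tangent map of the inverse chart. -/
theorem contDiffOn_metricRep (hg : IsSmoothMetric n M) (c : M) :
    ContDiffOn ℝ ∞ (metricRep (M := M) c) (extChartAt (𝓡 n) c).target := by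
  have hopen : IsOpen (extChartAt (𝓡 n) c).target := isOpen_extChartAt_target c
  have hsec (v : EuclideanSpace ℝ (Fin n)) :
      ContMDiffOn 𝓘(ℝ, EuclideanSpace ℝ (Fin n)) (𝓡 n).tangent ∞
        (fun y => (⟨(extChartAt (𝓡 n) c).symm y, dSymm c y v⟩ : TangentBundle (𝓡 n) M))
        (extChartAt (𝓡 n) c).target := by
    have h1 := (contMDiffOn_extChartAt_symm (I := 𝓡 n) (n := ∞) c).contMDiffOn_tangentMapWithin
      (m := ∞) (by simp) hopen.uniqueMDiffOn
    have h2 : ContMDiffOn 𝓘(ℝ, EuclideanSpace ℝ (Fin n))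
        (𝓘(ℝ, EuclideanSpace ℝ (Fin n))).tangent ∞
        (fun y => (⟨y, v⟩ : TangentBundle 𝓘(ℝ, EuclideanSpace ℝ (Fin n))
          (EuclideanSpace ℝ (Fin n)))) (extChartAt (𝓡 n) c).target :=
      contMDiffOn_vectorSpace_iff_contDiffOn.2 contDiffOn_const
    refine (h1.comp h2 fun y hy => hy).congr fun y hy => ?_
    simp only [Function.comp_apply, tangentMapWithin, dSymm]
    rw [mfderivWithin_of_isOpen hopen hy]
    rfl
  refine contDiffOn_clm_apply.2 fun v => contDiffOn_clm_apply.2 fun w => ?_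
  exact ((hsec v).inner_bundle (hsec w)).contDiffOn

theorem metricRep_isInvertible (c : M) {y : EuclideanSpace ℝ (Fin n)}
    (hy : y ∈ (extChartAt (𝓡 n) c).target) : (metricRep (M := M) c y).IsInvertible := by
  have hinj : Function.Injective (metricRep (M := M) c y) := by
    refine (injective_iff_map_eq_zero _).2 fun v hv => ?_
    have h1 : metricRep (M := M) c y v v = 0 := by rw [hv]; rfl
    rw [metricRep_apply, inner_self_eq_zero] at h1
    exact dSymm_injective c hy (h1.trans (map_zero _).symm)
  have hfin : Module.finrank ℝ (EuclideanSpace ℝ (Fin n)) =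
      Module.finrank ℝ (EuclideanSpace ℝ (Fin n) →L[ℝ] ℝ) := by
    rw [← (LinearMap.toContinuousLinearMap (𝕜 := ℝ) (E := EuclideanSpace ℝ (Fin n))
      (F' := ℝ)).finrank_eq]
    exact Subspace.dual_finrank_eq.symm
  exact ⟨(LinearEquiv.ofInjectiveOfFinrankEq (metricRep (M := M) c y).toLinearMap hinj
    hfin).toContinuousLinearEquiv, by ext; rfl⟩

/-- The basis dual to the constant basis `b` with respect to the metric in the chart around `c`. -/
def dualFrame {ι : Type*} (c : M) (b : Module.Basis ι ℝ (EuclideanSpace ℝ (Fin n)))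
    (y : EuclideanSpace ℝ (Fin n)) (i : ι) : EuclideanSpace ℝ (Fin n) :=
  (metricRep (M := M) c y).inverse (LinearMap.toContinuousLinearMap (b.coord i))

variable {ι : Type*} (b : Module.Basis ι ℝ (EuclideanSpace ℝ (Fin n)))

theorem metricRep_dualFrame (c : M) {y : EuclideanSpace ℝ (Fin n)}
    (hy : y ∈ (extChartAt (𝓡 n) c).target) (i : ι) :
    metricRep (M := M) c y (dualFrame (M := M) c b y i) =
      LinearMap.toContinuousLinearMap (b.coord i) :=
  (metricRep_isInvertible c hy).self_apply_inverse _

theorem contDiffAt_dualFrame (hg : IsSmoothMetric n M) (c : M) {y : EuclideanSpace ℝ (Fin n)}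
    (hy : y ∈ (extChartAt (𝓡 n) c).target) (i : ι) :
    ContDiffAt ℝ ∞ (fun y => dualFrame (M := M) c b y i) y :=
  ((metricRep_isInvertible c hy).contDiffAt_map_inverse.comp y
    ((contDiffOn_metricRep hg c).contDiffAt
      ((isOpen_extChartAt_target c).mem_nhds hy))).clm_apply contDiffAt_const

theorem sum_inner_dualFrame_smul [Fintype ι] (c : M) {y : EuclideanSpace ℝ (Fin n)}
    (hy : y ∈ (extChartAt (𝓡 n) c).target) (v : TM n ((extChartAt (𝓡 n) c).symm y)) :
    ∑ i, inner ℝ (dSymm c y (dualFrame (M := M) c b y i)) v • dSymm c y (b i) = v := by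
  obtain ⟨w, rfl⟩ := dSymm_surjective c hy v
  have h1 (i : ι) : inner ℝ (dSymm c y (dualFrame (M := M) c b y i)) (dSymm c y w) =
      b.coord i w := by
    rw [← metricRep_apply, metricRep_dualFrame b c hy]
    rfl
  simp_rw [h1, ← map_smul, ← map_sum]
  congr 1
  exact b.sum_repr w

theorem formInner_eq_sum_rep [Fintype ι] {k : ℕ} (α β : Form n M k) (c : M)
    {y : EuclideanSpace ℝ (Fin n)} (hy : y ∈ (extChartAt (𝓡 n) c).target) :
    formInner (α ((extChartAt (𝓡 n) c).symm y)) (β ((extChartAt (𝓡 n) c).symm y)) =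
      (k.factorial : ℝ)⁻¹ * ∑ i : Fin k → ι, rep α c y (fun r => b (i r)) *
        rep β c y (fun r => dualFrame (M := M) c b y (i r)) :=
  formInner_eq_sum (V := TM n ((extChartAt (𝓡 n) c).symm y)) (fun i => dSymm c y (b i))
    (fun i => dSymm c y (dualFrame (M := M) c b y i)) (sum_inner_dualFrame_smul b c hy) _ _

theorem rep_star_eq_sum [Fintype ι] {k l : ℕ} (h : k + l = n) (o : Orient n M) (α : Form n M k)
    (c : M) {y : EuclideanSpace ℝ (Fin n)} (hy : y ∈ (extChartAt (𝓡 n) c).target) :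
    rep (star h o α) c y = (k.factorial : ℝ)⁻¹ • ∑ i : Fin k → ι,
      rep α c y (fun r => b (i r)) •
        fix k (rep (fun x => volForm (h.symm.trans (Nat.add_comm k l)) (o x) : Form n M (l + k))
          c y) (fun r => dualFrame (M := M) c b y (i r)) := by
  have h1 := hodge_eq_sum (V := TM n ((extChartAt (𝓡 n) c).symm y)) (fun i => dSymm c y (b i))
    (fun i => dSymm c y (dualFrame (M := M) c b y i)) (sum_inner_dualFrame_smul b c hy) h
    (o ((extChartAt (𝓡 n) c).symm y)) (α ((extChartAt (𝓡 n) c).symm y))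
  ext w
  refine (DFunLike.congr_fun h1 (fun i => dSymm c y (w i))).trans ?_
  simp only [ContinuousAlternatingMap.smul_apply, ContinuousAlternatingMap.sum_apply]
  congr 1
  refine Finset.sum_congr rfl fun i _ => ?_
  congr 1
  exact (DFunLike.congr_fun (fix_compContinuousLinearMap (W := EuclideanSpace ℝ (Fin n))
    (V := TM n ((extChartAt (𝓡 n) c).symm y)) (volForm (h.symm.trans (Nat.add_comm k l))
      (o ((extChartAt (𝓡 n) c).symm y))) (dSymm c y)
      (fun r => dualFrame (M := M) c b y (i r))) w).symm

end Chart

theorem contDiffAt_alternating_apply {E : Type*} [NormedAddCommGroup E] [NormedSpace ℝ E] {k : ℕ}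
    {f : E → E [⋀^Fin k]→L[ℝ] ℝ} {v : E → Fin k → E} {y : E} {r : ℕ∞ω} (hf : ContDiffAt ℝ r f y)
    (hv : ∀ i, ContDiffAt ℝ r (fun y => v y i) y) : ContDiffAt ℝ r (fun y => f y (v y)) y := by
  induction k with
  | zero =>
    have h1 := (ContinuousAlternatingMap.apply ℝ E ℝ (v y)).contDiff.contDiffAt.comp y hf
    refine h1.congr_of_eventuallyEq (Eventually.of_forall fun z => ?_)
    exact congrArg _ (Subsingleton.elim _ _)
  | succ k ih =>
    let T : (E [⋀^Fin (k + 1)]→L[ℝ] ℝ) →L[ℝ] E →L[ℝ] E [⋀^Fin k]→L[ℝ] ℝ :=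
      ContinuousAlternatingMap.curryLeftLI.toContinuousLinearMap
    have hL : ContDiff ℝ r T := by fun_prop
    have hc : ContDiffAt ℝ r (fun y => (f y).curryLeft) y := hL.contDiffAt.comp y hf
    have h1 := ih (f := fun y => (f y).curryLeft (v y 0)) (v := fun y => Fin.tail (v y))
      (hc.clm_apply (hv 0)) fun i => hv i.succ
    refine h1.congr_of_eventuallyEq (Eventually.of_forall fun z => ?_)
    exact congrArg (f z) (Fin.cons_self_tail (v z)).symm

/-- Leibniz rule for a varying form evaluated at varying vectors. -/
theorem hasFDerivAt_alternating_apply {E : Type*} [NormedAddCommGroup E] [NormedSpace ℝ E] {k : ℕ}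
    {f : E → E [⋀^Fin k]→L[ℝ] ℝ} {f' : E →L[ℝ] E [⋀^Fin k]→L[ℝ] ℝ} {g : Fin k → E → E}
    {g' : Fin k → E →L[ℝ] E} {y : E} (hf : HasFDerivAt f f' y)
    (hg : ∀ i, HasFDerivAt (g i) (g' i) y) :
    ∃ D : E →L[ℝ] ℝ, HasFDerivAt (fun y => f y (fun i => g i y)) D y ∧
      ∀ u, D u = f' u (fun i => g i y) +
        ∑ r, f y (Function.update (fun i => g i y) r (g' r u)) := by
  have hT : HasFDerivAt (fun g : E [⋀^Fin k]→L[ℝ] ℝ => g.toContinuousMultilinearMap)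
      (ContinuousAlternatingMap.toContinuousMultilinearMapCLM ℝ) (f y) :=
    (ContinuousAlternatingMap.toContinuousMultilinearMapCLM (𝕜 := ℝ) (ι := Fin k) (E := E) (F := ℝ)
      ℝ).hasFDerivAt
  have h1 : HasFDerivAt (fun y => (f y).toContinuousMultilinearMap) _ y := hT.comp y hf
  refine ⟨_, h1.continuousMultilinearMap_apply hg, fun u => ?_⟩
  simp

/-! ### Regularity and derivatives of the star and the squared norm -/

section Chart

open Bundle

variable {n : ℕ} {M : Type*} [TopologicalSpace M] [ChartedSpace (EuclideanSpace ℝ (Fin n)) M]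

theorem IsCr.contDiffAt {k : ℕ} {η : Form n M k} (hη : IsCr 1 η) (c : M)
    {y : EuclideanSpace ℝ (Fin n)} (hy : y ∈ (extChartAt (𝓡 n) c).target) :
    ContDiffAt ℝ 1 (rep η c) y :=
  (hη c).contDiffAt ((isOpen_extChartAt_target c).mem_nhds hy)

variable [RiemannianBundle (fun x : M => TM n x)]

theorem IsOrientation.isCr_volForm {o : Orient n M} (ho : IsOrientation o) {m : ℕ} (h : n = m) :
    IsCr ∞ (fun x => volForm h (o x) : Form n M m) := by
  subst h
  exact ho

variable [IsManifold (𝓡 n) ∞ M]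

variable {ι : Type*} (b : Module.Basis ι ℝ (EuclideanSpace ℝ (Fin n)))

/-- The coefficients of the Hodge star in the chart around `c`. -/
def starCoeff {k l : ℕ} (h : k + l = n) (o : Orient n M) (c : M) (i : Fin k → ι)
    (y : EuclideanSpace ℝ (Fin n)) : EuclideanSpace ℝ (Fin n) [⋀^Fin l]→L[ℝ] ℝ :=
  fix k (rep (fun x => volForm (h.symm.trans (Nat.add_comm k l)) (o x) : Form n M (l + k)) c y)
    (fun r => dualFrame (M := M) c b y (i r))

theorem contDiffAt_starCoeff (hg : IsSmoothMetric n M) {o : Orient n M} (ho : IsOrientation o)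
    {k l : ℕ} (h : k + l = n) (c : M) (i : Fin k → ι) {y : EuclideanSpace ℝ (Fin n)}
    (hy : y ∈ (extChartAt (𝓡 n) c).target) :
    ContDiffAt ℝ 1 (starCoeff b h o c i) y :=
  contDiffAt_fix ((((ho.isCr_volForm _) c).contDiffAt
    ((isOpen_extChartAt_target c).mem_nhds hy)).of_le (by simp))
    fun r => (contDiffAt_dualFrame b hg c hy (i r)).of_le (by simp)

theorem eventually_rep_star_eq [Fintype ι] {k l : ℕ} (h : k + l = n) (o : Orient n M)
    (α : Form n M k) (c : M) {y : EuclideanSpace ℝ (Fin n)}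
    (hy : y ∈ (extChartAt (𝓡 n) c).target) :
    rep (star h o α) c =ᶠ[𝓝 y] fun y => (k.factorial : ℝ)⁻¹ • ∑ i : Fin k → ι,
      rep α c y (fun r => b (i r)) • starCoeff b h o c i y := by
  filter_upwards [(isOpen_extChartAt_target c).mem_nhds hy] with z hz
  exact rep_star_eq_sum b h o α c hz

theorem contDiffAt_rep_star (hg : IsSmoothMetric n M) {o : Orient n M} (ho : IsOrientation o)
    {k l : ℕ} (h : k + l = n) {η : Form n M k} (hη : IsCr 1 η) (c : M)
    {y : EuclideanSpace ℝ (Fin n)} (hy : y ∈ (extChartAt (𝓡 n) c).target) :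
    ContDiffAt ℝ 1 (rep (star h o η) c) y := by
  refine ContDiffAt.congr_of_eventuallyEq ?_
    (eventually_rep_star_eq (EuclideanSpace.basisFun (Fin n) ℝ).toBasis h o η c hy)
  refine ContDiffAt.const_smul _ (ContDiffAt.sum fun i _ => ContDiffAt.fun_smul ?_
    (contDiffAt_starCoeff _ hg ho h c i hy))
  exact contDiffAt_alternating_apply (hη.contDiffAt c hy) fun _ => contDiffAt_const

/-- The coefficients do not depend on `η`, so `C¹` convergence of forms passes to `d⋆`. -/
theorem fderiv_rep_star [Fintype ι] (hg : IsSmoothMetric n M) {o : Orient n M}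
    (ho : IsOrientation o)
    {k l : ℕ} (h : k + l = n) {η : Form n M k} (hη : IsCr 1 η) (c : M)
    {y : EuclideanSpace ℝ (Fin n)} (hy : y ∈ (extChartAt (𝓡 n) c).target)
    (u : EuclideanSpace ℝ (Fin n)) (w : Fin l → EuclideanSpace ℝ (Fin n)) :
    fderiv ℝ (rep (star h o η) c) y u w = (k.factorial : ℝ)⁻¹ * ∑ i : Fin k → ι,
      (rep η c y (fun r => b (i r)) * fderiv ℝ (starCoeff b h o c i) y u w +
        fderiv ℝ (rep η c) y u (fun r => b (i r)) * starCoeff b h o c i y w) := by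
  have hd := (hη.contDiffAt c hy).differentiableAt one_ne_zero
  have h2 (i : Fin k → ι) : DifferentiableAt ℝ (starCoeff b h o c i) y :=
    (contDiffAt_starCoeff b hg ho h c i hy).differentiableAt one_ne_zero
  have h3 (i : Fin k → ι) := ((contDiffAt_alternating_apply (v := fun _ r => b (i r))
    (hη.contDiffAt c hy) fun _ => contDiffAt_const).differentiableAt one_ne_zero).hasFDerivAt.fun_smul (h2 i).hasFDerivAt
  rw [(eventually_rep_star_eq b h o η c hy).fderiv_eq,
    ((HasFDerivAt.fun_sum fun i (_ : i ∈ Finset.univ) => h3 i).fun_const_smul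
      (k.factorial : ℝ)⁻¹).fderiv]
  simp only [fderiv_continuousAlternatingMap_apply_const hd]
  simp [ContinuousAlternatingMap.sum_apply]

theorem contDiffAt_formInner_self (hg : IsSmoothMetric n M) {k : ℕ} {η : Form n M k}
    (hη : IsCr 1 η) (c : M) {y : EuclideanSpace ℝ (Fin n)}
    (hy : y ∈ (extChartAt (𝓡 n) c).target) :
    ContDiffAt ℝ 1 (fun y => formInner (η ((extChartAt (𝓡 n) c).symm y))
      (η ((extChartAt (𝓡 n) c).symm y))) y := by
  set b := (EuclideanSpace.basisFun (Fin n) ℝ).toBasis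
  have heq : (fun y => formInner (η ((extChartAt (𝓡 n) c).symm y))
      (η ((extChartAt (𝓡 n) c).symm y))) =ᶠ[𝓝 y] fun y => (k.factorial : ℝ)⁻¹ *
        ∑ i : Fin k → Fin n, rep η c y (fun r => b (i r)) *
          rep η c y (fun r => dualFrame (M := M) c b y (i r)) := by
    filter_upwards [(isOpen_extChartAt_target c).mem_nhds hy] with z hz
    exact formInner_eq_sum_rep b η η c hz
  refine ContDiffAt.congr_of_eventuallyEq ?_ heq
  refine contDiffAt_const.mul (ContDiffAt.sum fun i _ => ?_)
  exact (contDiffAt_alternating_apply (v := fun _ r => b (i r)) (hη.contDiffAt c hy)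
    fun _ => contDiffAt_const).mul
    (contDiffAt_alternating_apply (hη.contDiffAt c hy) fun r =>
      (contDiffAt_dualFrame b hg c hy (i r)).of_le (by simp))

end Chart

theorem exists_forall_apply_basis {V : Type*} [NormedAddCommGroup V] [InnerProductSpace ℝ V]
    {ι : Type*} [Fintype ι] (e : OrthonormalBasis ι ℝ V) (v : ι → V) :
    ∃ A : V →L[ℝ] V, ∀ a, A (e a) = v a := by
  classical
  refine ⟨∑ a, (innerSL ℝ (e a)).smulRight (v a), fun a => ?_⟩
  simp [orthonormal_iff_ite.1 e.orthonormal]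

/-! ### Metric compatibility of the Levi-Civita connection -/

section Chart

open Bundle

variable {n : ℕ} {M : Type*} [TopologicalSpace M] [ChartedSpace (EuclideanSpace ℝ (Fin n)) M]

section

variable [RiemannianBundle (fun x : M => TM n x)]

theorem inner_christoffel (x : M) (u w : TM n x) (b : Fin (Module.finrank ℝ (TM n x))) :
    inner ℝ (stdOrthonormalBasis ℝ (TM n x) b) (christoffel x u w) =
      koszul (metricRep (M := M) x) (extChartAt (𝓡 n) x x) (dChart x u)
        (dChart x (stdOrthonormalBasis ℝ (TM n x) b)) (dChart x w) := by
  classical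
  rw [christoffel, sum_apply]
  simp only [ContinuousLinearMap.smulRight_apply, inner_sum, real_inner_smul_right,
    orthonormal_iff_ite.1 (stdOrthonormalBasis ℝ (TM n x)).orthonormal]
  simp

theorem gradInner_apply {k : ℕ} (F : Form n M k) (x : M) (u : TM n x) :
    gradInner F x u = formInner (covD F x u) (F x) := rfl

end

variable [IsManifold (𝓡 n) ∞ M]

/-- The derivative at `x` of the chart around `x`, as a linear equivalence. -/
def dChartEquiv (x : M) : TM n x ≃ₗ[ℝ] EuclideanSpace ℝ (Fin n) :=
  LinearEquiv.ofInjectiveOfFinrankEq (dChart (n := n) x).toLinearMap (dChart_injective x)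
    ((Fact.out : Module.finrank ℝ (TM n x) = n).trans finrank_euclideanSpace_fin.symm)

theorem dChartEquiv_apply (x : M) (u : TM n x) : dChartEquiv x u = dChart x u := rfl

variable [RiemannianBundle (fun x : M => TM n x)]

/-- The image under the chart around `x` of an orthonormal basis of the tangent space at `x`. -/
def chartBasis (x : M) :
    Module.Basis (Fin (Module.finrank ℝ (TM n x))) ℝ (EuclideanSpace ℝ (Fin n)) :=
  (stdOrthonormalBasis ℝ (TM n x)).toBasis.map (dChartEquiv x)

theorem chartBasis_apply (x : M) (a : Fin (Module.finrank ℝ (TM n x))) :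
    chartBasis x a = dChart x (stdOrthonormalBasis ℝ (TM n x) a) := by
  simp [chartBasis, dChartEquiv_apply]

theorem chartBasis_coord_dChart (x : M) (a : Fin (Module.finrank ℝ (TM n x))) (v : TM n x) :
    (chartBasis x).coord a (dChart x v) = inner ℝ (stdOrthonormalBasis ℝ (TM n x) a) v := by
  rw [← dChartEquiv_apply, ← OrthonormalBasis.repr_apply_apply]
  simp [chartBasis]

theorem dualFrame_chartBasis_self (x : M) (a : Fin (Module.finrank ℝ (TM n x))) :
    dualFrame (M := M) x (chartBasis x) (extChartAt (𝓡 n) x x) a = chartBasis x a := by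
  rw [dualFrame, (metricRep_isInvertible x (mem_extChartAt_target x)).inverse_apply_eq]
  ext w
  obtain ⟨v, rfl⟩ := (dChartEquiv x).surjective w
  rw [dChartEquiv_apply, chartBasis_apply, metricRep_dChart]
  exact chartBasis_coord_dChart x a v

/-- Differentiate the constant `g(β_a, ·)`, where `β` is the dual frame; at the base point `β_a` is
the frame vector itself, because the frame is orthonormal there. -/
theorem metricRep_fderiv_dualFrame (hg : IsSmoothMetric n M) (x : M)
    (a : Fin (Module.finrank ℝ (TM n x))) (u w : EuclideanSpace ℝ (Fin n)) :
    metricRep (M := M) x (extChartAt (𝓡 n) x x)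
        (fderiv ℝ (fun y => dualFrame (M := M) x (chartBasis x) y a) (extChartAt (𝓡 n) x x) u) w =
      - fderiv ℝ (metricRep (M := M) x) (extChartAt (𝓡 n) x x) u (chartBasis x a) w := by
  have ht := mem_extChartAt_target (I := 𝓡 n) x
  have hn := (isOpen_extChartAt_target (I := 𝓡 n) x).mem_nhds ht
  have h1 : HasFDerivAt (metricRep (M := M) x) _ (extChartAt (𝓡 n) x x) :=
    (((contDiffOn_metricRep hg x).contDiffAt hn).differentiableAt (by simp)).hasFDerivAt
  have h2 : HasFDerivAt (fun y => dualFrame (M := M) x (chartBasis x) y a) _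
      (extChartAt (𝓡 n) x x) :=
    ((contDiffAt_dualFrame (chartBasis x) hg x ht a).differentiableAt (by simp)).hasFDerivAt
  have h3 : (fun y => metricRep (M := M) x y (dualFrame (M := M) x (chartBasis x) y a)) =ᶠ[
      𝓝 (extChartAt (𝓡 n) x x)]
      fun _ => LinearMap.toContinuousLinearMap ((chartBasis x).coord a) := by
    filter_upwards [hn] with y hy
    exact metricRep_dualFrame (chartBasis x) x hy a
  have h4 := (h1.clm_apply h2).unique ((hasFDerivAt_const _ _).congr_of_eventuallyEq h3)
  have h5 := DFunLike.congr_fun (DFunLike.congr_fun h4 u) w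
  simp only [dualFrame_chartBasis_self] at h5
  have h6 : metricRep (M := M) x (extChartAt (𝓡 n) x x)
        (fderiv ℝ (fun y => dualFrame (M := M) x (chartBasis x) y a) (extChartAt (𝓡 n) x x) u) w +
      fderiv ℝ (metricRep (M := M) x) (extChartAt (𝓡 n) x x) u (chartBasis x a) w = 0 := h5
  linarith

/-- The squared norm is differentiated in a constant frame and its dual, so the variation of the
metric enters only through the dual frame. -/
theorem fderiv_formInner_self (hg : IsSmoothMetric n M) {k : ℕ} {F : Form n M k} (hF : IsCr 1 F)
    (x : M) (u : TM n x) :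
    fderiv ℝ (fun y => formInner (F ((extChartAt (𝓡 n) x).symm y))
      (F ((extChartAt (𝓡 n) x).symm y))) (extChartAt (𝓡 n) x x) (dChart x u) =
      2 * gradInner F x u := by
  have ht := mem_extChartAt_target (I := 𝓡 n) x
  have hn := (isOpen_extChartAt_target (I := 𝓡 n) x).mem_nhds ht
  set y₀ := extChartAt (𝓡 n) x x with hy₀
  set e := stdOrthonormalBasis ℝ (TM n x) with he
  set b := chartBasis (n := n) x with hb
  have hbe (a) : b a = dChart x (e a) := chartBasis_apply x a
  have hf : HasFDerivAt (rep F x) (fderiv ℝ (rep F x) y₀) y₀ :=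
    ((hF.contDiffAt x ht).differentiableAt one_ne_zero).hasFDerivAt
  have hβ (a) : HasFDerivAt (fun y => dualFrame (M := M) x b y a)
      (fderiv ℝ (fun y => dualFrame (M := M) x b y a) y₀) y₀ :=
    ((contDiffAt_dualFrame b hg x ht a).differentiableAt (by simp)).hasFDerivAt
  -- `B` sends `e a` to the derivative along `u` of the `a`-th dual frame vector, brought back to
  -- the tangent space; differentiating the arguments of `F` then becomes the derivation action of
  -- `B`.
  obtain ⟨B, hB⟩ := exists_forall_apply_basis e (fun a => (dChartEquiv x).symm
    (fderiv ℝ (fun y => dualFrame (M := M) x b y a) y₀ (dChart x u)))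
  have hLB (a) : dChart x (B (e a)) =
      fderiv ℝ (fun y => dualFrame (M := M) x b y a) y₀ (dChart x u) := by
    rw [hB, ← dChartEquiv_apply, LinearEquiv.apply_symm_apply]
  set φ : TM n x [⋀^Fin k]→L[ℝ] ℝ :=
    (fderiv ℝ (rep F x) y₀ (dChart x u)).compContinuousLinearMap (dChart x) with hφ
  choose D hD hDu using fun i : Fin k → Fin (Module.finrank ℝ (TM n x)) =>
    hasFDerivAt_alternating_apply hf (fun r => hβ (i r))
  have hconst (i : Fin k → Fin (Module.finrank ℝ (TM n x))) :=
    hf.continuousAlternatingMap_apply_const (fun r => b (i r))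
  have heq : (fun y => formInner (F ((extChartAt (𝓡 n) x).symm y))
      (F ((extChartAt (𝓡 n) x).symm y))) =ᶠ[𝓝 y₀] fun y => (k.factorial : ℝ)⁻¹ *
        ∑ i : Fin k → Fin (Module.finrank ℝ (TM n x)), rep F x y (fun r => b (i r)) *
          rep F x y (fun r => dualFrame (M := M) x b y (i r)) := by
    filter_upwards [hn] with z hz
    exact formInner_eq_sum_rep b F F x hz
  have hq := ((HasFDerivAt.fun_sum fun i (_ : i ∈ Finset.univ) =>
    (hconst i).fun_mul (hD i)).const_mul (k.factorial : ℝ)⁻¹).congr_of_eventuallyEq heq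
  rw [hq.fderiv]
  have hFe (i : Fin k → Fin (Module.finrank ℝ (TM n x))) :
      rep F x y₀ (fun r => b (i r)) = F x (fun r => e (i r)) := by
    simp_rw [hbe]
    exact rep_dChart F x _
  have hact (i : Fin k → Fin (Module.finrank ℝ (TM n x))) :
      ∑ r, rep F x y₀ (Function.update (fun r => b (i r)) r
        (fderiv ℝ (fun y => dualFrame (M := M) x b y (i r)) y₀ (dChart x u))) =
      act B (F x) (fun r => e (i r)) := by
    rw [act_apply]
    refine Finset.sum_congr rfl fun r _ => ?_
    rw [← rep_dChart F x, ← hLB]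
    congr 1
    funext s
    by_cases hs : s = r
    · subst hs; simp
    · simp [hs, hbe]
  have hφe (i : Fin k → Fin (Module.finrank ℝ (TM n x))) :
      fderiv ℝ (rep F x) y₀ (dChart x u) (fun r => b (i r)) = φ (fun r => e (i r)) := by
    simp_rw [hbe]
    rfl
  have hself (i : Fin k → Fin (Module.finrank ℝ (TM n x))) :
      (fun r => dualFrame (M := M) x b y₀ (i r)) = fun r => b (i r) :=
    funext fun r => dualFrame_chartBasis_self x (i r)
  have hsum : ((k.factorial : ℝ)⁻¹ • ∑ i, (rep F x y₀ (fun r => b (i r)) • D i +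
      rep F x y₀ (fun r => dualFrame (M := M) x b y₀ (i r)) •
        (fderiv ℝ (rep F x) y₀).flipAlternating (fun r => b (i r)))) (dChart x u) =
      2 * formInner φ (F x) + formInner (act B (F x)) (F x) := by
    have hDi (i) : D i (dChart x u) = φ (fun r => e (i r)) + act B (F x) (fun r => e (i r)) := by
      rw [hDu, ← hact, ← hφe]
      rw [hself]
    simp only [smul_apply, sum_apply, add_apply, hDi, hFe, hself, smul_eq_mul,
      ContinuousLinearMap.flipAlternating_apply_apply, hφe]
    rw [formInner, formInner, mul_left_comm, ← mul_add]
    congr 1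
    rw [Finset.mul_sum, ← Finset.sum_add_distrib]
    refine Finset.sum_congr rfl fun i _ => ?_
    ring
  rw [hsum, gradInner_apply]
  have hcov : φ = covD F x u + act (christoffel x u) (F x) := by
    rw [covD]
    exact (sub_add_cancel _ _).symm
  -- After `∂_u F = ∇_u F + Γ_u · F`, the surplus is the action of `B + 2Γ_u`. Its matrix is `∂_a
  -- g(u, e_c) - ∂_c g(u, e_a)`: the term `∂_u g` of `2Γ_u` cancels `B`, and the rest is skew.
  have hskew := formInner_act_of_skew (B + (2 : ℝ) • christoffel x u) (F x) fun a c => ?_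
  · rw [act_add, act_smul, formInner_add_left, formInner_smul_left] at hskew
    rw [hcov, formInner_add_left]
    linarith
  · have hBi (a c) : inner ℝ (e c) (B (e a)) =
        - fderiv ℝ (metricRep (M := M) x) y₀ (dChart x u) (b a) (b c) := by
      rw [← metricRep_fderiv_dualFrame hg, ← hLB, hbe, real_inner_comm, metricRep_dChart]
    simp only [add_apply, smul_apply, inner_add_right, real_inner_smul_right]
    rw [hBi, hBi, inner_christoffel, inner_christoffel]
    simp only [koszul, hbe, smul_apply, add_apply, sub_apply, ContinuousLinearMap.flip_apply,
      smul_eq_mul]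
    ring

end Chart

/-! ### Wedge identities and pointwise limits of the algebraic operations -/

section Wedge

variable {V : Type*} [NormedAddCommGroup V] [NormedSpace ℝ V] {k : ℕ}

theorem wedge_apply (θ : V →L[ℝ] ℝ) (α : V [⋀^Fin k]→L[ℝ] ℝ) (v : Fin (k + 1) → V) :
    wedge θ α v = ∑ i : Fin (k + 1), (-1) ^ (i : ℕ) * (θ (v i) * α (i.removeNth v)) := by
  simp [wedge, ContinuousAlternatingMap.alternatizeUncurryFin_apply]

theorem wedge_smul_left (c : ℝ) (θ : V →L[ℝ] ℝ) (α : V [⋀^Fin k]→L[ℝ] ℝ) :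
    wedge (c • θ) α = c • wedge θ α := by
  ext v
  simp only [wedge_apply, ContinuousAlternatingMap.smul_apply, smul_apply, smul_eq_mul,
    Finset.mul_sum]
  exact Finset.sum_congr rfl fun i _ => by ring

theorem wedge_smul_right (c : ℝ) (θ : V →L[ℝ] ℝ) (α : V [⋀^Fin k]→L[ℝ] ℝ) :
    wedge θ (c • α) = c • wedge θ α := by
  ext v
  simp only [wedge_apply, ContinuousAlternatingMap.smul_apply, smul_eq_mul, Finset.mul_sum]
  exact Finset.sum_congr rfl fun i _ => by ring

theorem wedge_zero_right (θ : V →L[ℝ] ℝ) : wedge θ (0 : V [⋀^Fin k]→L[ℝ] ℝ) = 0 := by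
  simpa using wedge_smul_right 0 θ (0 : V [⋀^Fin k]→L[ℝ] ℝ)

theorem wedge_zero_left (α : V [⋀^Fin k]→L[ℝ] ℝ) : wedge 0 α = 0 := by
  simpa using wedge_smul_left 0 (0 : V →L[ℝ] ℝ) α

theorem toCovector_apply (s : V [⋀^Fin 1]→L[ℝ] ℝ) (u : V) : toCovector s u = s fun _ => u := rfl

theorem toCovector_zero : toCovector (0 : V [⋀^Fin 1]→L[ℝ] ℝ) = 0 := rfl

theorem wedge_toCovector_wedge_self (θ : V →L[ℝ] ℝ) (s : V [⋀^Fin 1]→L[ℝ] ℝ) :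
    wedge (toCovector s) (wedge θ s) = 0 := by
  ext v
  rw [wedge_apply]
  have h (i : Fin 3) (j : Fin 2) : i.removeNth v j = v (i.succAbove j) := rfl
  have hs (i : Fin 3) (j : Fin 2) :
      s (j.removeNth (i.removeNth v)) = toCovector s (v (i.succAbove (j.succAbove 0))) := by
    rw [toCovector_apply]
    congr 1
    ext a
    rw [Subsingleton.elim a 0]
    rfl
  simp only [wedge_apply, Fin.sum_univ_succ, Fin.sum_univ_zero, h, hs]
  simp [Fin.succAbove, Fin.lt_def]
  ring

theorem tendsto_wedge {ι : Type*} {L : Filter ι} {θ : ι → V →L[ℝ] ℝ} {θ₀ : V →L[ℝ] ℝ}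
    {α : ι → V [⋀^Fin k]→L[ℝ] ℝ} {α₀ : V [⋀^Fin k]→L[ℝ] ℝ}
    (hθ : ∀ u, Tendsto (fun i => θ i u) L (𝓝 (θ₀ u)))
    (hα : ∀ w, Tendsto (fun i => α i w) L (𝓝 (α₀ w))) (v : Fin (k + 1) → V) :
    Tendsto (fun i => wedge (θ i) (α i) v) L (𝓝 (wedge θ₀ α₀ v)) := by
  simp only [wedge_apply]
  exact tendsto_finsetSum _ fun i _ => ((hθ _).mul (hα _)).const_mul _

end Wedge

section InnerProduct

variable {V : Type*} [NormedAddCommGroup V] [InnerProductSpace ℝ V] [FiniteDimensional ℝ V]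
  {n k l : ℕ} {ι : Type*} {L : Filter ι}

theorem tendsto_formInner {α β : ι → V [⋀^Fin k]→L[ℝ] ℝ} {α₀ β₀ : V [⋀^Fin k]→L[ℝ] ℝ}
    (hα : ∀ w, Tendsto (fun i => α i w) L (𝓝 (α₀ w)))
    (hβ : ∀ w, Tendsto (fun i => β i w) L (𝓝 (β₀ w))) :
    Tendsto (fun i => formInner (α i) (β i)) L (𝓝 (formInner α₀ β₀)) :=
  (tendsto_finsetSum _ fun _ _ => (hα _).mul (hβ _)).const_mul _

theorem tendsto_hodge [Fact (Module.finrank ℝ V = n)] (h : k + l = n)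
    (o : Orientation ℝ V (Fin n)) {α : ι → V [⋀^Fin k]→L[ℝ] ℝ} {α₀ : V [⋀^Fin k]→L[ℝ] ℝ}
    (hα : ∀ w, Tendsto (fun i => α i w) L (𝓝 (α₀ w))) (w : Fin l → V) :
    Tendsto (fun i => hodge h o (α i) w) L (𝓝 (hodge h o α₀ w)) := by
  simp only [hodge, ContinuousAlternatingMap.smul_apply, ContinuousAlternatingMap.sum_apply,
    smul_eq_mul]
  exact (tendsto_finsetSum _ fun _ _ => (hα _).mul_const _).const_mul _

theorem formNorm_sq (α : V [⋀^Fin k]→L[ℝ] ℝ) : formNorm α ^ 2 = formInner α α :=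
  Real.sq_sqrt (formInner_self_nonneg α)

theorem formInner_zero_right (α : V [⋀^Fin k]→L[ℝ] ℝ) : formInner α 0 = 0 := by
  simp [formInner]

end InnerProduct

/-! ### The equations for `p`-tight forms -/

section Manifold

open Bundle

variable {n k l : ℕ} {M : Type*} [TopologicalSpace M] [ChartedSpace (EuclideanSpace ℝ (Fin n)) M]

theorem extD_apply (η : Form n M k) (x : M) (v : Fin (k + 1) → TM n x) :
    extD η x v = ∑ i : Fin (k + 1), (-1) ^ (i : ℕ) *
      fderiv ℝ (rep η x) (extChartAt (𝓡 n) x x) (dChart x (v i))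
        (fun j => dChart x (i.removeNth v j)) := by
  change extDeriv (rep η x) (extChartAt (𝓡 n) x x) (fun i => dChart x (v i)) = _
  rw [extDeriv, ContinuousAlternatingMap.alternatizeUncurryFin_apply]
  simp only [zsmul_eq_mul]
  push_cast
  rfl

theorem IsWeaklyClosed.extD_eq_zero {η : Form n M k} (hη : IsWeaklyClosed η) (h1 : IsCr 1 η)
    (x : M) : extD η x = 0 := by
  rw [extD, hη.extDeriv_rep_eq_zero x (mem_extChartAt_target x)
    (h1.contDiffAt x (mem_extChartAt_target x))]
  rfl

theorem TendstoC1.tendsto_rep {ι : Type*} {L : Filter ι} {η : ι → Form n M k} {η₀ : Form n M k}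
    (h : TendstoC1 η L η₀) (x : M) (w : Fin k → EuclideanSpace ℝ (Fin n)) :
    Tendsto (fun i => rep (η i) x (extChartAt (𝓡 n) x x) w) L
      (𝓝 (rep η₀ x (extChartAt (𝓡 n) x x) w)) :=
  ((ContinuousAlternatingMap.apply ℝ (EuclideanSpace ℝ (Fin n)) ℝ w).continuous.tendsto _).comp
    ((h.2.2 x).1.tendsto_at (mem_extChartAt_target x))

theorem TendstoC1.tendsto_fderiv_rep {ι : Type*} {L : Filter ι} {η : ι → Form n M k}
    {η₀ : Form n M k} (h : TendstoC1 η L η₀) (x : M) (u : EuclideanSpace ℝ (Fin n))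
    (w : Fin k → EuclideanSpace ℝ (Fin n)) :
    Tendsto (fun i => fderiv ℝ (rep (η i) x) (extChartAt (𝓡 n) x x) u w) L
      (𝓝 (fderiv ℝ (rep η₀ x) (extChartAt (𝓡 n) x x) u w)) :=
  ((ContinuousAlternatingMap.apply ℝ (EuclideanSpace ℝ (Fin n)) ℝ w).continuous.tendsto _).comp
    (((ContinuousLinearMap.apply ℝ _ u).continuous.tendsto _).comp
      ((h.2.2 x).2.tendsto_at (mem_extChartAt_target x)))

theorem TendstoC1.tendsto_extD {ι : Type*} {L : Filter ι} {η : ι → Form n M k}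
    {η₀ : Form n M k} (h : TendstoC1 η L η₀) (x : M) (v : Fin (k + 1) → TM n x) :
    Tendsto (fun i => extD (η i) x v) L (𝓝 (extD η₀ x v)) := by
  simp only [extD_apply]
  exact tendsto_finsetSum _ fun i _ => (h.tendsto_fderiv_rep x _ _).const_mul _

section

variable [RiemannianBundle (fun x : M => TM n x)]

theorem rep_star_smul (h : k + l = n) (o : Orient n M) (f : M → ℝ) (F : Form n M k) (c : M)
    (y : EuclideanSpace ℝ (Fin n)) :
    rep (star h o (fun x => f x • F x)) c y =
      f ((extChartAt (𝓡 n) c).symm y) • rep (star h o F) c y := by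
  ext w
  exact DFunLike.congr_fun (hodge_smul h (o ((extChartAt (𝓡 n) c).symm y)) _ _) _

theorem normF_rpow (F : Form n M k) (x : M) (p : ℝ) :
    normF F x ^ (p - 2) = formInner (F x) (F x) ^ ((p - 2) / 2) := by
  rw [normF, formNorm, Real.sqrt_eq_rpow, ← Real.rpow_mul (formInner_self_nonneg _)]
  congr 1
  ring

theorem normF_sq (F : Form n M k) (x : M) : normF F x ^ 2 = formInner (F x) (F x) :=
  formNorm_sq _

end

variable [IsManifold (𝓡 n) ∞ M]

theorem TendstoC1.tendsto_apply {ι : Type*} {L : Filter ι} {η : ι → Form n M k} {η₀ : Form n M k}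
    (h : TendstoC1 η L η₀) (x : M) (w : Fin k → TM n x) :
    Tendsto (fun i => η i x w) L (𝓝 (η₀ x w)) := by
  simp only [← rep_dChart]
  exact h.tendsto_rep x _

variable [RiemannianBundle (fun x : M => TM n x)]

theorem TendstoC1.tendsto_gradInner {ι : Type*} {L : Filter ι} {η : ι → Form n M k}
    {η₀ : Form n M k} (h : TendstoC1 η L η₀) (x : M) (u : TM n x) :
    Tendsto (fun i => gradInner (η i) x u) L (𝓝 (gradInner η₀ x u)) := by
  simp only [gradInner_apply]
  refine tendsto_formInner (fun w => ?_) (h.tendsto_apply x)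
  simp only [covD, ContinuousAlternatingMap.sub_apply, act_apply]
  exact (h.tendsto_fderiv_rep x _ _).sub (tendsto_finsetSum _ fun _ _ => h.tendsto_apply x _)

theorem TendstoC1.tendsto_extD_star (hg : IsSmoothMetric n M) {o : Orient n M}
    (ho : IsOrientation o) (hkl : k + l = n) {ι : Type*} {L : Filter ι} {η : ι → Form n M k}
    {η₀ : Form n M k} (h : TendstoC1 η L η₀) (x : M) (v : Fin (l + 1) → TM n x) :
    Tendsto (fun i => extD (star hkl o (η i)) x v) L (𝓝 (extD (star hkl o η₀) x v)) := by
  simp only [extD_apply]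
  refine tendsto_finsetSum _ fun i _ => Tendsto.const_mul _ ?_
  have ht := mem_extChartAt_target (I := 𝓡 n) x
  rw [fderiv_rep_star (chartBasis (n := n) x) hg ho hkl h.2.1 x ht]
  refine Tendsto.congr' (h.1.mono fun j hj =>
    (fderiv_rep_star (chartBasis (n := n) x) hg ho hkl hj x ht _ _).symm) ?_
  exact (tendsto_finsetSum _ fun _ _ => ((h.tendsto_rep x _).mul_const _).add
    ((h.tendsto_fderiv_rep x _ _).mul_const _)).const_mul _

theorem IsPTight.wedge_gradInner_add (hg : IsSmoothMetric n M) {o : Orient n M}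
    (ho : IsOrientation o) (h : k + l = n) {p : ℝ} (hp : 2 < p) {F : Form n M k}
    (hF1 : IsCr 1 F) (hF : IsPTight h o p F) (x : M) :
    wedgeF (gradInner F) (star h o F) x +
      (normF F x ^ 2 / (p - 2)) • extD (star h o F) x = 0 := by
  rw [normF_sq]
  -- At a zero of `F` both terms vanish, and the power of the norm need not be differentiable there.
  by_cases h0 : F x = 0
  · have h1 : star h o F x = 0 := by rw [star, h0, hodge_zero]
    rw [wedgeF, h1, wedge_zero_right, h0, formInner_zero_right, zero_div, zero_smul, add_zero]
  have ht := mem_extChartAt_target (I := 𝓡 n) x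
  set y₀ := extChartAt (𝓡 n) x x with hy₀
  set q : EuclideanSpace ℝ (Fin n) → ℝ := fun y => formInner (F ((extChartAt (𝓡 n) x).symm y))
      (F ((extChartAt (𝓡 n) x).symm y)) with hq
  have hqx : q y₀ = formInner (F x) (F x) :=
    congrArg (fun z => formInner (F z) (F z)) (extChartAt_to_inv (I := 𝓡 n) x)
  have hq0 : 0 < q y₀ := by
    rw [hqx]
    exact (formInner_self_nonneg _).lt_of_ne fun h => h0 (formInner_self_eq_zero h.symm)
  have hqC : ContDiffAt ℝ 1 q y₀ := contDiffAt_formInner_self hg hF1 x ht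
  set a : ℝ := (p - 2) / 2 with ha
  have hG : rep (star h o (fun x => normF F x ^ (p - 2) • F x)) x =
      fun y => q y ^ a • rep (star h o F) x y := by
    funext y
    rw [rep_star_smul h o (fun x => normF F x ^ (p - 2)), normF_rpow]
  have hsC := contDiffAt_rep_star hg ho h hF1 x ht
  have hpC : ContDiffAt ℝ 1 (fun y => q y ^ a) y₀ := hqC.rpow_const_of_ne hq0.ne'
  -- Positivity of `q` makes the product `C¹` at this point, so its weak closedness holds here
  -- classically.
  have hd := hF.2.extDeriv_rep_eq_zero x ht (by rw [hG]; exact hpC.fun_smul hsC)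
  have hqd := (hqC.differentiableAt one_ne_zero).hasFDerivAt
  have hsd := (hsC.differentiableAt one_ne_zero).hasFDerivAt
  rw [hG, extDeriv, ((hqd.rpow_const (Or.inl hq0.ne')).fun_smul hsd).fderiv] at hd
  have key : ∀ v, wedgeF (gradInner F) (star h o F) x v =
      - (formInner (F x) (F x) / (p - 2)) * extD (star h o F) x v := by
    intro v
    have h1 := DFunLike.congr_fun hd (fun i => dChart x (v i))
    rw [ContinuousAlternatingMap.alternatizeUncurryFin_apply] at h1
    have hsx (i : Fin (l + 1)) : rep (star h o F) x y₀ (i.removeNth fun i => dChart x (v i)) =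
        star h o F x (i.removeNth v) := rep_dChart (star h o F) x _
    have h2 : ∑ i : Fin (l + 1), (-1) ^ (i : ℕ) * (q y₀ ^ a *
        fderiv ℝ (rep (star h o F) x) y₀ (dChart x (v i)) (fun j => dChart x (i.removeNth v j)) +
        a * q y₀ ^ (a - 1) * (2 * gradInner F x (v i)) * star h o F x (i.removeNth v)) = 0 := by
      refine Eq.trans (Finset.sum_congr rfl fun i _ => ?_) h1
      have hr : (i.removeNth fun i => dChart x (v i)) =
        fun j => dChart x (i.removeNth v j) := rfl
      rw [← fderiv_formInner_self hg hF1 x (v i), ← hsx, hr]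
      simp only [add_apply, smul_apply, ContinuousLinearMap.smulRight_apply,
        ContinuousAlternatingMap.add_apply, ContinuousAlternatingMap.smul_apply, smul_eq_mul,
        zsmul_eq_mul, hq]
      push_cast
      ring
    -- The positive factor `q ^ (a - 1)` is common to both Leibniz terms; the `2` from the
    -- derivative of `q` makes `2 * a = p - 2`.
    have h3 : q y₀ ^ a = q y₀ ^ (a - 1) * q y₀ := by
      rw [← Real.rpow_add_one hq0.ne', sub_add_cancel]
    have h4 : q y₀ ^ (a - 1) * (q y₀ * extD (star h o F) x v +
        (p - 2) * wedgeF (gradInner F) (star h o F) x v) = 0 := by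
      rw [← h2, extD_apply, wedgeF, wedge_apply, Finset.mul_sum, Finset.mul_sum,
        ← Finset.sum_add_distrib, Finset.mul_sum]
      refine Finset.sum_congr rfl fun i _ => ?_
      rw [h3, ha]
      ring
    have h5 := (mul_eq_zero.1 h4).resolve_left (Real.rpow_pos_of_pos hq0 _).ne'
    have h6 : p - 2 ≠ 0 := by linarith
    rw [hqx] at h5
    field_simp
    linarith
  ext v
  rw [ContinuousAlternatingMap.add_apply, key, ContinuousAlternatingMap.smul_apply, smul_eq_mul]
  change _ = (0 : ℝ)
  ring

/-- Where `F ≠ 0`, the third equation makes `d⋆F` a multiple of `⟨∇F, F⟩ ∧ ⋆F`, which is killed by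
`⋆F`. -/
theorem IsPTight.wedge_extD_star_eq_zero (hg : IsSmoothMetric n M) {o : Orient n M}
    (ho : IsOrientation o) (h : k + 1 = n) {p : ℝ} (hp : 2 < p) {F : Form n M k}
    (hF1 : IsCr 1 F) (hF : IsPTight h o p F) (x : M) :
    wedgeF (toCovectorField (star h o F)) (extD (star h o F)) x = 0 := by
  by_cases h0 : F x = 0
  · have h1 : star h o F x = 0 := by rw [star, h0, hodge_zero]
    rw [wedgeF, toCovectorField, h1, toCovector_zero, wedge_zero_left]
  have h1 := hF.wedge_gradInner_add hg ho h hp hF1 x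
  have h2 : normF F x ^ 2 / (p - 2) ≠ 0 := by
    rw [normF_sq]
    exact div_ne_zero (fun h => h0 (formInner_self_eq_zero h)) (by linarith)
  have h3 := congrArg (wedge (toCovector (star h o F x))) (eq_neg_of_add_eq_zero_right h1)
  rw [← neg_one_smul ℝ (wedgeF _ _ _), wedge_smul_right, wedge_smul_right, wedgeF,
    wedge_toCovector_wedge_self, smul_zero] at h3
  exact (smul_eq_zero.1 h3).resolve_left h2

end Manifold

/-! ### Passage to the limit `p → ∞` -/

section Limit

open Bundle

variable {n k l : ℕ} {M : Type*} [TopologicalSpace M] [ChartedSpace (EuclideanSpace ℝ (Fin n)) M]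
  [IsManifold (𝓡 n) ∞ M] [RiemannianBundle (fun x : M => TM n x)]

theorem tight_system_of_tendstoC1 (hg : IsSmoothMetric n M) {o : Orient n M}
    (ho : IsOrientation o) (h : k + 1 = n) {Fp : ℝ → Form n M k} {F : Form n M k} {L : Filter ℝ}
    [L.NeBot] (hL : L ≤ atTop) (hFp : ∀ p : ℝ, 2 < p → IsPTight h o p (Fp p))
    (hF : TendstoC1 Fp L F) (x : M) :
    extD F x = 0 ∧
      wedgeF (toCovectorField (star h o F)) (extD (star h o F)) x = 0 ∧
      wedgeF (gradInner F) (star h o F) x = 0 := by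
  have hp : ∀ᶠ p in L, 2 < p := hL (eventually_gt_atTop 2)
  have hstar (w : Fin 1 → TM n x) :
      Tendsto (fun p => star h o (Fp p) x w) L (𝓝 (star h o F x w)) :=
    tendsto_hodge h (o x) (hF.tendsto_apply x) w
  have hcov (u : TM n x) : Tendsto (fun p => toCovectorField (star h o (Fp p)) x u) L
      (𝓝 (toCovectorField (star h o F) x u)) := hstar fun _ => u
  have hdstar := hF.tendsto_extD_star hg ho h x
  refine ⟨?_, ?_, ?_⟩
  · ext v
    refine tendsto_nhds_unique_of_eventuallyEq (hF.tendsto_extD x v) tendsto_const_nhds ?_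
    filter_upwards [hp, hF.1] with p hp2 hp1
    rw [(hFp p hp2).1.extD_eq_zero hp1]
  · ext v
    refine tendsto_nhds_unique_of_eventuallyEq
      (tendsto_wedge hcov hdstar v) tendsto_const_nhds ?_
    filter_upwards [hp, hF.1] with p hp2 hp1
    exact DFunLike.congr_fun ((hFp p hp2).wedge_extD_star_eq_zero hg ho h hp2 hp1 x) v
  · ext v
    have hsq : Tendsto (fun p => normF (Fp p) x ^ 2) L (𝓝 (normF F x ^ 2)) := by
      simp only [normF_sq]
      exact tendsto_formInner (hF.tendsto_apply x) (hF.tendsto_apply x)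
    -- The numerator converges, hence stays bounded, and `d⋆F_p` converges too, so the second term
    -- of the third equation disappears.
    have hc : Tendsto (fun p => normF (Fp p) x ^ 2 / (p - 2)) L (𝓝 0) :=
      hsq.div_atTop ((tendsto_atTop_add_const_right _ (-2) tendsto_id).mono_left hL)
    have hlim := (tendsto_wedge (hF.tendsto_gradInner x) hstar v).add (hc.mul (hdstar v))
    rw [zero_mul, add_zero] at hlim
    refine tendsto_nhds_unique_of_eventuallyEq hlim tendsto_const_nhds ?_
    filter_upwards [hp, hF.1] with p hp2 hp1
    exact DFunLike.congr_fun ((hFp p hp2).wedge_gradInner_add hg ho h hp2 hp1 x) v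

end Limit

end PTight

end

theorem mainTheorem7 {m : ℕ} {M : Type*} [TopologicalSpace M]
    [ChartedSpace (EuclideanSpace ℝ (Fin (m + 2))) M] [IsManifold (𝓡 (m + 2)) ∞ M]
    [Bundle.RiemannianBundle (fun x : M => TangentSpace (𝓡 (m + 2)) x)]
    (hg : PTight.IsSmoothMetric (m + 2) M)
    (o : PTight.Orient (m + 2) M) (ho : PTight.IsOrientation o) :
    -- `p`-tight forms of class `C¹`
    (∀ (p : ℝ) (F : PTight.Form (m + 2) M (m + 1)), 2 < p → PTight.IsCr 1 F →
      PTight.IsPTight (l := 1) rfl o p F → ∀ x : M,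
        PTight.extD F x = 0 ∧
        PTight.wedgeF (PTight.toCovectorField (PTight.star (l := 1) rfl o F))
          (PTight.extD (PTight.star (l := 1) rfl o F)) x = 0 ∧
        PTight.wedgeF (PTight.gradInner F) (PTight.star (l := 1) rfl o F) x
          + (PTight.normF F x ^ 2 / (p - 2)) •
            PTight.extD (PTight.star (l := 1) rfl o F) x = 0 ∧
        PTight.iota (PTight.gradInner F) F x
          - (PTight.normF F x ^ 2 / (p - 2)) • PTight.codiff (l := 1) rfl o F x = 0) ∧
    -- limits of `p`-tight forms in `C¹` as `p → ∞`
    (∀ (Fp : ℝ → PTight.Form (m + 2) M (m + 1)) (F : PTight.Form (m + 2) M (m + 1))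
      (L : Filter ℝ), L.NeBot → L ≤ atTop →
      (∀ p : ℝ, 2 < p → PTight.IsPTight (l := 1) rfl o p (Fp p)) →
      PTight.TendstoC1 Fp L F → ∀ x : M,
        PTight.extD F x = 0 ∧
        PTight.wedgeF (PTight.toCovectorField (PTight.star (l := 1) rfl o F))
          (PTight.extD (PTight.star (l := 1) rfl o F)) x = 0 ∧
        PTight.wedgeF (PTight.gradInner F) (PTight.star (l := 1) rfl o F) x = 0 ∧
        PTight.IndexEq F x) ∧
    -- the last equation and its rewriting are equivalent, for every form of class `C¹`
    (∀ F : PTight.Form (m + 2) M (m + 1), PTight.IsCr 1 F → ∀ x : M,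
      (∀ p : ℝ, 2 < p →
        (PTight.wedgeF (PTight.gradInner F) (PTight.star (l := 1) rfl o F) x
            + (PTight.normF F x ^ 2 / (p - 2)) •
              PTight.extD (PTight.star (l := 1) rfl o F) x = 0 ↔
          PTight.iota (PTight.gradInner F) F x
            - (PTight.normF F x ^ 2 / (p - 2)) • PTight.codiff (l := 1) rfl o F x = 0)) ∧
      (PTight.wedgeF (PTight.gradInner F) (PTight.star (l := 1) rfl o F) x = 0 ↔
        PTight.IndexEq F x)) := by
  refine ⟨fun p F hp hF1 hF x => ?_, fun Fp F L hL hLt hFp hF x => ?_, fun F _ x =>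
    ⟨fun p _ => PTight.wedge_add_smul_extD_eq_zero_iff o F _ x,
      PTight.wedge_eq_zero_iff_indexEq o F x⟩⟩
  · have h3 := PTight.IsPTight.wedge_gradInner_add (k := m + 1) (l := 1) (F := F) hg ho rfl
      hp hF1 hF x
    exact ⟨hF.1.extD_eq_zero hF1 x, hF.wedge_extD_star_eq_zero (k := m + 1) hg ho rfl hp hF1 x,
      h3, (PTight.wedge_add_smul_extD_eq_zero_iff o F _ x).1 h3⟩
  · obtain ⟨h1, h2, h3⟩ := PTight.tight_system_of_tendstoC1 hg ho rfl hLt hFp hF x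
    exact ⟨h1, h2, h3, (PTight.wedge_eq_zero_iff_indexEq o F x).1 h3⟩
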